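/- **Notation.** Below, $\mathcal N(m,s)$ is the normal distribution on $\mathbb R$ with mean $m$ and standard deviation $s\ge 0$ (a point mass if $s=0$). For $\mu,p\in\mathbb R^K$ with $p$ a probability vector, $\mathit{MoG}(\mu,p,\sigma)=\sum_{k=1}^K p_k\,\mathcal N(\mu_k,\sigma)$. For probability measures $P,Q$ and $\alpha\ge 0$, $H_\alpha(P\|Q)=\int\max\{\frac{dP}{dQ}-\alpha,0\}\,dQ+P^{\perp}(\text{whole space})$ is the hockey stick divergence, where $\frac{dP}{dQ}$ is the density of the $Q$-absolutely continuous part and $P^\perp$ the $Q$-singular part of $P$ (zero if $P\ll Q$), and $\mathrm{TVD}(P,Q)=H_1(P\|Q)$. **Data.** A dataset is $x=(x_1,\dots,x_N)$ with $x_n\in\mathbb R^L$. For $v\ge0$, write $x\simeq x'$ ($(1,v)$-event-level neighboring) if $x$ and $x'$ differ in at most one series $x_n$, in there at most at one time step, and by at most $v$ in absolute value. **Mechanism.** Let the context length $L_C$ and the forecast length $L_F$ satisfy $L-L_F+1\ge L_C+L_F$. Let $\lambda,\Lambda\ge1$ be integers with $\lfloor\Lambda/\lambda\rfloor\le N$,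 let $f_\vartheta$ be a model with weights $\vartheta\in\mathbb R^D$ that maps $\mathbb R^{L_C}$ to an arbitrary set, and let $\ell$ be a real-valued loss comparing a model output with an element of $\mathbb R^{L_F}$. Fix current weights $\theta$ and suppose that the gradient $g(c,z)=\nabla_\theta\,\ell(f_\theta(c),z)$ (set to $0$ where $\ell(f_\vartheta(c),z)$ is not differentiable in $\vartheta$ at $\theta$) is a measurable function of $(c,z)\in\mathbb R^{L_C}\times\mathbb R^{L_F}$. Let $\eta\in\mathbb R$, $\sigma,\sigma_C,\sigma_F\ge0$ and $C>0$. Let $\hat M_x$ be the distribution of the output of the following training step on $x$. 1. Draw a uniformly random permutation $\pi$ of $\{1,\dots,N\}$ and select the series $x_{\pi(1)},\dots,x_{\pi(N')}$ with $N'=\lfloor\Lambda/\lambda\rfloor$. 2. For each selected series, prepend $L_C$ zeros and, $\lambda$ times independently, draw $t$ uniformly from $\{1,\dots,L-L_F+1\}$ and take the entries at positions $t,\dots,t+L_C+L_F-1$ of the padded series. The result is a subsequence $y_i$, whose first $L_C$ entries form $y_{C,i}$ and whose last $L_F$ entries form $y_{F,i}$. 3. Put $g_i=g(y_{C,i}+Z_{C,i},\,y_{F,i}+Z_{F,i})$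 with fresh independent noise $Z_{C,i}\sim\mathcal N(0,\sigma_C^2v^2I)$ and $Z_{F,i}\sim\mathcal N(0,\sigma_F^2v^2I)$. 4. Return $\theta-\eta\cdot\frac1\Lambda\Big(\sum_i g_i/\max\{1,\|g_i\|_2/C\}+Z\Big)$ with independent $Z\sim\mathcal N(0,\sigma^2C^2I)$ in $\mathbb R^D$. **Theorem.** Let $\lambda=1$ and $\sigma_C=\sigma_F$. Put $r=\frac{L_C+L_F}{L-L_F+1}$, $\rho=\lfloor\Lambda/\lambda\rfloor/N$, and $$p_2=\rho\cdot r\cdot\mathrm{TVD}\big(\mathcal N(0,\sigma_F),\mathcal N(1,\sigma_F)\big),\qquad p_1=1-p_2 .$$ Then $p_1,p_2\in[0,1]$. With $\hat P=\mathit{MoG}\big((0,2),(p_1,p_2),\sigma\big)$, the per-step privacy profile $\hat H(\alpha)=\sup_{x\simeq x'}H_\alpha(\hat M_x\|\hat M_{x'})$ satisfies $$\hat H(\alpha)\le\begin{cases}H_\alpha\big(\hat P\,\|\,\mathcal N(0,\sigma)\big)&\text{if }\alpha\ge1,\\ H_\alpha\big(\mathcal N(0,\sigma)\,\|\,\hat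 P\big)&\text{if }0\le\alpha<1.\end{cases}$$ -/

import Mathlib

open MeasureTheory ProbabilityTheory
open scoped NNReal ENNReal

namespace DPForecast

noncomputable section

/-! ### Divergences and Gaussian mixtures -/

/-- Hockey stick divergence `H_α(P ‖ Q) = ∫ max (dP/dQ - α, 0) dQ`, with `dP/dQ = ∞` on the part
of the space that carries the `Q`-singular part of `P` (whence the second summand, which vanishes
if `P ≪ Q`). The subtraction in `ℝ≥0∞` is truncated at `0`. -/
def hockeyStick {E : Type*} [MeasurableSpace E] (α : ℝ≥0) (P Q : Measure E) : ℝ≥0∞ :=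
  (∫⁻ o, (P.rnDeriv Q o - (α : ℝ≥0∞)) ∂Q) + P.singularPart Q Set.univ

/-- Total variation distance, `TVD(P, Q) = H_1(P ‖ Q)`. -/
def tvd {E : Type*} [MeasurableSpace E] (P Q : Measure E) : ℝ :=
  (hockeyStick 1 P Q).toReal

/-- The univariate normal distribution with mean `m` and standard deviation `|s|`
(a point mass if `s = 0`). -/
def normal (m s : ℝ) : Measure ℝ := gaussianReal m (s ^ 2).toNNReal

/-- The mixture of Gaussians `∑ k, p k • 𝒩(μ k, σ)`. -/
def mog {K : ℕ} (μ p : Fin K → ℝ) (σ : ℝ) : Measure ℝ :=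
  ∑ k, ENNReal.ofReal (p k) • normal (μ k) σ

/-- The mixture of the finitely many measures `μ i` with equal weights. -/
def uniformMixture {ι E : Type*} [Fintype ι] [MeasurableSpace E] (μ : ι → Measure E) :
    Measure E :=
  (Fintype.card ι : ℝ≥0∞)⁻¹ • ∑ i, μ i

/-! ### Datasets of time series and their neighboring relation -/

/-- Two datasets of `N` series of length `L` are `(w, v)`-event-level neighboring: they differ in
at most one series, there only within a range of `w` consecutive time steps, and by at most `v`
at each step. -/
def EventNeighbor {N L : ℕ} (w : ℕ) (v : ℝ) (x x' : Fin N → Fin L → ℝ) : Prop :=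
  ∃ n : Fin N, (∀ m, m ≠ n → x m = x' m) ∧
    (∃ t : ℕ, ∀ s : Fin L, x n s ≠ x' n s → t ≤ s ∧ (s : ℕ) < t + w) ∧
    ∀ s : Fin L, |x n s - x' n s| ≤ v

/-! ### Subsequences -/

/-- The subsequence of length `LC + LF` that starts at (zero-based) position `t` of the series `a`
with `LC` zeros prepended. There are `L - LF + 1` possible start positions. -/
def subsequence {L : ℕ} (LC LF : ℕ) (a : Fin L → ℝ) (t : Fin (L + 1 - LF)) :
    Fin (LC + LF) → ℝ :=
  fun k => Fin.append (0 : Fin LC → ℝ) a ⟨t + k, by omega⟩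

/-- The first `LC` entries. -/
def contextWindow {LC LF : ℕ} (y : Fin (LC + LF) → ℝ) : Fin LC → ℝ :=
  fun k => y (Fin.castAdd LF k)

/-- The last `LF` entries. -/
def forecastWindow {LC LF : ℕ} (y : Fin (LC + LF) → ℝ) : Fin LF → ℝ :=
  fun k => y (Fin.natAdd LC k)

/-! ### The training step -/

/-- The gradient `∇_θ ℓ(f_θ(c), z)` of the loss with respect to the weights
(`0` if the loss is not differentiable there). -/
def lossGradient {LC LF D : ℕ} {O : Type*} (f : EuclideanSpace ℝ (Fin D) → (Fin LC → ℝ) → O)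
    (ℓ : O → (Fin LF → ℝ) → ℝ) (θ : EuclideanSpace ℝ (Fin D))
    (c : Fin LC → ℝ) (z : Fin LF → ℝ) : EuclideanSpace ℝ (Fin D) :=
  gradient (fun ϑ => ℓ (f ϑ c) z) θ

/-- Clipping to norm `C`, that is, `g / max {1, ‖g‖ / C}`. -/
def clip {D : ℕ} (C : ℝ) (g : EuclideanSpace ℝ (Fin D)) : EuclideanSpace ℝ (Fin D) :=
  (max 1 (‖g‖ / C))⁻¹ • g

/-- The updated weights after one step, given the batch `y` (with `lam` subsequences from each of
`N'` series), the noise `zC`, `zF` added to the context and forecast windows, and the noise `z`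
added to the sum of clipped gradients. -/
def trainingStep {LC LF D N' lam : ℕ} {O : Type*} (Λ : ℕ)
    (f : EuclideanSpace ℝ (Fin D) → (Fin LC → ℝ) → O) (ℓ : O → (Fin LF → ℝ) → ℝ)
    (θ : EuclideanSpace ℝ (Fin D)) (η C : ℝ)
    (y : Fin N' → Fin lam → Fin (LC + LF) → ℝ)
    (zC : Fin N' → Fin lam → Fin LC → ℝ) (zF : Fin N' → Fin lam → Fin LF → ℝ)
    (z : Fin D → ℝ) : EuclideanSpace ℝ (Fin D) :=
  θ - η • ((1 / (Λ : ℝ)) •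
    ((∑ n, ∑ j, clip C (lossGradient f ℓ θ
        (contextWindow (y n j) + zC n j) (forecastWindow (y n j) + zF n j)))
      + WithLp.toLp 2 z))

/-- The output distribution on dataset `x` of a single training step with
* top-level sampling without replacement: the first `⌊Λ / lam⌋` series after a uniformly random
  permutation `π`;
* bottom-level sampling with replacement: `lam` independent uniformly random start positions
  `t n j` for each selected series;
* independent Gaussian noise with standard deviations `σC * v` and `σF * v` added to each entry of
  each context and forecast window;
* independent Gaussian noise with standard deviation `σ * C` added to each coordinate of the sum
  of clipped gradients. -/
def stepLaw {L LC LF D N : ℕ} {O : Type*} (lam Λ : ℕ) (hN : Λ / lam ≤ N)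
    (f : EuclideanSpace ℝ (Fin D) → (Fin LC → ℝ) → O) (ℓ : O → (Fin LF → ℝ) → ℝ)
    (θ : EuclideanSpace ℝ (Fin D)) (η σ C σC σF v : ℝ)
    (x : Fin N → Fin L → ℝ) : Measure (EuclideanSpace ℝ (Fin D)) :=
  uniformMixture
    fun ω : Equiv.Perm (Fin N) × (Fin (Λ / lam) → Fin lam → Fin (L + 1 - LF)) =>
      Measure.map
        (fun Z : (Fin (Λ / lam) → Fin lam → Fin LC → ℝ) ×
            (Fin (Λ / lam) → Fin lam → Fin LF → ℝ) × (Fin D → ℝ) =>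
          trainingStep Λ f ℓ θ η C
            (fun n j => subsequence LC LF (x (ω.1 (Fin.castLE hN n))) (ω.2 n j))
            Z.1 Z.2.1 Z.2.2)
        ((Measure.pi fun _ => Measure.pi fun _ => Measure.pi fun _ => normal 0 (σC * v)).prod
          ((Measure.pi fun _ => Measure.pi fun _ => Measure.pi fun _ => normal 0 (σF * v)).prod
            (Measure.pi fun _ => normal 0 (σ * C))))

end

end DPForecast

open DPForecast

namespace DPForecast

/-! ### Test bounds and the hockey stick divergence -/

/-! Divergences are handled through tests: `H_α(P ‖ Q)` is the least `h` with `P S ≤ α Q S + h` for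
all measurable `S`, and for `α ≤ 1` passing to complements turns a bound on `H_α(Q ‖ P)` into `α P S
≤ Q S + (h - (1 - α))`. Both regimes of the theorem are thus instances of `k P S ≤ a Q S + h` with
`k ≤ a`, namely `(k, a) = (1, α)` and `(α, 1)`. It remains to transfer such a bound from the pair
(mixture, `𝒩(0, σ)`) to the pair of step laws (`testBound_stepLaw`).

One series. With `lam = 1` a single window is drawn, and at most `LC + LF` of the `L - LF + 1`
windows see the changed entry. If the window does, one Gaussian coordinate moves by at most `v` at
noise level `σF * v`, which a test detects with advantage at most `τ = TVD(𝒩(0, σF), 𝒩(1, σF))`. So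
the laws of the clipped gradient of the changed series are within `δ = r τ` in total variation
(`testBound_seriesLaw`).

The batch. Let `Φ w` be the probability that `w` plus output noise lands in `S`. Fix the other
members of a batch, and let `m`, `M` be the infimum and supremum of `Φ` when the remaining
contribution ranges over the ball of radius `C`. Batches with the changed series `n` have means of
`Φ` differing by at most `δ (M - m)`. Batches in which `n` is exchanged for an unselected series
agree on both datasets, and their mean is at least `m`. Since `N p₂ = N' δ`, averaging leaves `k p₂
M ≤ (a - k + k p₂) m + h` to be shown (`exchange_le`, `sum_perm_lintegral_le`).

This last inequality is the assumed bound for the mixture: cancelling its component `𝒩(0, σ)` gives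
a test bound with constants `k p₂` and `a - k + k p₂` for `𝒩(2, σ)` against `𝒩(0, σ)`
(`testBound_of_mog`). It passes to isotropic noise of level `σ C` because points of the ball are at
most `2 C` apart and, by Neyman–Pearson, smaller shifts are harder to detect
(`TestBound.gaussian_translate`). -/

/-- Every test of `P` against `Q` satisfies `k * P S ≤ a * Q S + h`. -/
def TestBound {E : Type*} [MeasurableSpace E] (k a : ℝ≥0) (h : ℝ≥0∞) (P Q : Measure E) : Prop :=
  ∀ S, MeasurableSet S → (k : ℝ≥0∞) * P S ≤ a * Q S + h

section TestBound

variable {E F : Type*} [MeasurableSpace E] [MeasurableSpace F] {k a : ℝ≥0} {h : ℝ≥0∞}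

lemma testBound_refl (hka : k ≤ a) (P : Measure E) : TestBound k a h P P := fun S _ =>
  le_add_right (by gcongr)

lemma TestBound.map {P Q : Measure E} (H : TestBound k a h P Q) {f : E → F} (hf : Measurable f) :
    TestBound k a h (P.map f) (Q.map f) := fun S hS => by
  rw [Measure.map_apply hf hS, Measure.map_apply hf hS]
  exact H _ (hf hS)

/-- A test bound is preserved by adjoining an independent component with a common law. -/
lemma TestBound.prod_right {P Q : Measure E} [IsProbabilityMeasure P] [IsProbabilityMeasure Q]
    (H : TestBound k a h P Q) (ρ : Measure F) [IsProbabilityMeasure ρ] :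
    TestBound k a h (P.prod ρ) (Q.prod ρ) := fun S hS => by
  rw [Measure.prod_apply_symm hS, Measure.prod_apply_symm hS]
  calc (k : ℝ≥0∞) * ∫⁻ y, P ((fun x => (x, y)) ⁻¹' S) ∂ρ
      = ∫⁻ y, k * P ((fun x => (x, y)) ⁻¹' S) ∂ρ :=
        (lintegral_const_mul _ (measurable_measure_prodMk_right hS)).symm
    _ ≤ ∫⁻ y, (a * Q ((fun x => (x, y)) ⁻¹' S) + h) ∂ρ :=
        lintegral_mono fun y => H _ (measurable_prodMk_right hS)
    _ = a * ∫⁻ y, Q ((fun x => (x, y)) ⁻¹' S) ∂ρ + h := by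
        rw [lintegral_add_right _ measurable_const,
          lintegral_const_mul _ (measurable_measure_prodMk_right hS)]
        simp

lemma TestBound.prod_left {P Q : Measure E} [IsProbabilityMeasure P] [IsProbabilityMeasure Q]
    (H : TestBound k a h P Q) (R : Measure F) [IsProbabilityMeasure R] :
    TestBound k a h (R.prod P) (R.prod Q) := by
  have := (H.prod_right R).map measurable_swap
  rwa [Measure.prod_swap, Measure.prod_swap] at this

/-- A test bound for one component of a product measure gives one for the whole product. -/
lemma TestBound.pi {n : ℕ} {X : Type*} [MeasurableSpace X] {μ ν : Fin n → Measure X}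
    [∀ i, IsProbabilityMeasure (μ i)] [∀ i, IsProbabilityMeasure (ν i)] (j : Fin n)
    (H : TestBound k a h (μ j) (ν j)) (hne : ∀ i, i ≠ j → μ i = ν i) :
    TestBound k a h (Measure.pi μ) (Measure.pi ν) := by
  obtain _ | n := n
  · exact j.elim0
  have e : (fun i => μ (j.succAbove i)) = fun i => ν (j.succAbove i) :=
    funext fun i => hne _ (Fin.succAbove_ne j i)
  have h1 := (measurePreserving_piFinSuccAbove μ j).symm.map_eq
  have h2 := (measurePreserving_piFinSuccAbove ν j).symm.map_eq
  rw [← h1, ← h2]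
  simp only [e]
  exact (H.prod_right _).map (MeasurableEquiv.measurable _)

/-- The test bound given by the hockey stick divergence. -/
lemma testBound_hockeyStick (α : ℝ≥0) (P Q : Measure E) [IsFiniteMeasure P] [IsFiniteMeasure Q] :
    TestBound 1 α (hockeyStick α P Q) P Q := fun S hS => by
  have h1 : P S = P.singularPart Q S + ∫⁻ o in S, P.rnDeriv Q o ∂Q := by
    conv_lhs => rw [← Measure.singularPart_add_rnDeriv P Q]
    rw [Measure.add_apply, withDensity_apply _ hS]
  rw [ENNReal.coe_one, one_mul, h1, hockeyStick]
  calc P.singularPart Q S + ∫⁻ o in S, P.rnDeriv Q o ∂Q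
      ≤ P.singularPart Q Set.univ + ∫⁻ o in S, (α + (P.rnDeriv Q o - α)) ∂Q :=
        add_le_add (measure_mono (Set.subset_univ _)) (lintegral_mono fun o => le_add_tsub)
    _ ≤ P.singularPart Q Set.univ + (α * Q S + ∫⁻ o, (P.rnDeriv Q o - α) ∂Q) := by
        rw [lintegral_add_left measurable_const, setLIntegral_const]
        gcongr
        exact Measure.restrict_le_self
    _ = _ := by ring

/-- The hockey stick divergence is the least constant in a test bound. -/
lemma hockeyStick_le {α : ℝ≥0} {P Q : Measure E} [IsFiniteMeasure P] [IsFiniteMeasure Q]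
    (H : TestBound 1 α h P Q) : hockeyStick α P Q ≤ h := by
  obtain ⟨s, hs, hs1, hs2⟩ := Measure.mutuallySingular_singularPart P Q
  have hmeas := Measure.measurable_rnDeriv P Q
  set B : Set E := {o | (α : ℝ≥0∞) < P.rnDeriv Q o}
  have hB : MeasurableSet B := measurableSet_lt measurable_const hmeas
  -- The optimal test: `sᶜ` is `Q`-null and carries the singular part of `P`, and `B` is where the
  -- density exceeds `α`.
  have hT := H (sᶜ ∪ B) (hs.compl.union hB)
  have hQ : Q (sᶜ ∪ B) = Q B := by
    refine le_antisymm ((measure_union_le _ _).trans (by simp [hs2]))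
      (measure_mono Set.subset_union_right)
  have hP : P.singularPart Q Set.univ + ∫⁻ o in B, P.rnDeriv Q o ∂Q ≤ P (sᶜ ∪ B) := by
    conv_rhs => rw [← Measure.singularPart_add_rnDeriv P Q]
    rw [Measure.add_apply, withDensity_apply _ (hs.compl.union hB)]
    refine add_le_add ?_ (lintegral_mono_set Set.subset_union_right)
    rw [← Set.union_compl_self s]
    refine (measure_union_le _ _).trans ?_
    rw [hs1, zero_add]
    exact measure_mono Set.subset_union_left
  have hI : ∫⁻ o, (P.rnDeriv Q o - α) ∂Q = ∫⁻ o in B, (P.rnDeriv Q o - α) ∂Q := by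
    rw [← lintegral_indicator hB]
    refine lintegral_congr fun o => ?_
    by_cases ho : o ∈ B
    · rw [Set.indicator_of_mem ho]
    · rw [Set.indicator_of_notMem ho]
      exact tsub_eq_zero_of_le (not_lt.mp ho)
  have hI2 : ∫⁻ o in B, (P.rnDeriv Q o - α) ∂Q + α * Q B = ∫⁻ o in B, P.rnDeriv Q o ∂Q := by
    rw [← setLIntegral_const, ← lintegral_add_right _ measurable_const]
    exact setLIntegral_congr_fun hB fun o ho => tsub_add_cancel_of_le (le_of_lt ho)
  rw [hQ, ENNReal.coe_one, one_mul] at hT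
  rw [hockeyStick, hI]
  have hfin : (α : ℝ≥0∞) * Q B ≠ ∞ := ENNReal.mul_ne_top ENNReal.coe_ne_top (measure_ne_top _ _)
  refine (ENNReal.add_le_add_iff_right hfin).mp ?_
  calc _ = P.singularPart Q Set.univ + ∫⁻ o in B, P.rnDeriv Q o ∂Q := by rw [← hI2]; ring
    _ ≤ _ := hP.trans (hT.trans_eq (add_comm _ _))

lemma hockeyStick_le_one (α : ℝ≥0) (P Q : Measure E) [IsProbabilityMeasure P]
    [IsProbabilityMeasure Q] : hockeyStick α P Q ≤ 1 :=
  hockeyStick_le fun S _ => by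
    rw [ENNReal.coe_one, one_mul]
    exact le_add_left prob_le_one

lemma tvd_nonneg (P Q : Measure E) : 0 ≤ tvd P Q := ENNReal.toReal_nonneg

lemma tvd_le_one (P Q : Measure E) [IsProbabilityMeasure P] [IsProbabilityMeasure Q] :
    tvd P Q ≤ 1 :=
  ENNReal.toReal_le_of_le_ofReal zero_le_one (by simpa using hockeyStick_le_one 1 P Q)

/-- Passing to complements turns the test bound of `H_α(Q ‖ P)` into one for `P` against `Q`. -/
lemma testBound_hockeyStick_swap {α : ℝ≥0} (hα : α ≤ 1) (P Q : Measure E) [IsProbabilityMeasure P]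
    [IsProbabilityMeasure Q] :
    TestBound α 1 (hockeyStick α Q P - (1 - α)) P Q := fun S hS => by
  have H := testBound_hockeyStick α Q P Sᶜ hS.compl
  have H0 := testBound_hockeyStick α Q P Set.univ MeasurableSet.univ
  have hfin := ne_top_of_le_ne_top ENNReal.one_ne_top (hockeyStick_le_one α Q P)
  rw [prob_compl_eq_one_sub hS, prob_compl_eq_one_sub hS] at H
  simp only [measure_univ] at H0
  lift hockeyStick α Q P to ℝ≥0 using hfin with h
  have hPS : P S ≠ ∞ := measure_ne_top _ _
  have hQS : Q S ≠ ∞ := measure_ne_top _ _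
  have hP1 : P S ≤ 1 := prob_le_one
  have hQ1 : Q S ≤ 1 := prob_le_one
  lift P S to ℝ≥0 using hPS with p
  lift Q S to ℝ≥0 using hQS with q
  norm_cast at *
  have e1 : ((1 - α : ℝ≥0) : ℝ) = 1 - α := NNReal.coe_sub hα
  have e2 : ((1 - p : ℝ≥0) : ℝ) = 1 - p := NNReal.coe_sub hP1
  have e3 : ((1 - q : ℝ≥0) : ℝ) = 1 - q := NNReal.coe_sub hQ1
  have h1 : 1 - α ≤ h := by
    rw [← NNReal.coe_le_coe, e1]
    have : (1 : ℝ) * 1 ≤ α * 1 + h := by exact_mod_cast H0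
    linarith
  have e4 : ((h - (1 - α) : ℝ≥0) : ℝ) = h - (1 - α) := by rw [NNReal.coe_sub h1, e1]
  rw [← NNReal.coe_le_coe] at H ⊢
  push_cast [e2, e3, e4] at H ⊢
  linarith

/-- Converse of `testBound_hockeyStick_swap`. -/
lemma hockeyStick_le_of_testBound_swap {α : ℝ≥0} {P Q : Measure E} [IsProbabilityMeasure P]
    [IsProbabilityMeasure Q] (hα : α ≤ 1) (hh : 1 - α ≤ h) (H : TestBound α 1 (h - (1 - α)) P Q) :
    hockeyStick α Q P ≤ h := by
  refine hockeyStick_le fun S hS => ?_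
  by_cases hfin : h = ∞
  · simp [hfin]
  have H := H Sᶜ hS.compl
  rw [prob_compl_eq_one_sub hS, prob_compl_eq_one_sub hS] at H
  lift h to ℝ≥0 using hfin
  have hPS : P S ≠ ∞ := measure_ne_top _ _
  have hQS : Q S ≠ ∞ := measure_ne_top _ _
  have hP1 : P S ≤ 1 := prob_le_one
  have hQ1 : Q S ≤ 1 := prob_le_one
  lift P S to ℝ≥0 using hPS with p
  lift Q S to ℝ≥0 using hQS with q
  norm_cast at *
  have e1 : ((1 - α : ℝ≥0) : ℝ) = 1 - α := NNReal.coe_sub hα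
  have e2 : ((1 - p : ℝ≥0) : ℝ) = 1 - p := NNReal.coe_sub hP1
  have e3 : ((1 - q : ℝ≥0) : ℝ) = 1 - q := NNReal.coe_sub hQ1
  have e4 : ((h - (1 - α) : ℝ≥0) : ℝ) = h - (1 - α) := by rw [NNReal.coe_sub hh, e1]
  rw [← NNReal.coe_le_coe] at H ⊢
  push_cast [e2, e3, e4] at H ⊢
  linarith

/-- Take the whole space as the test. This keeps the truncated difference `h - (1 - α)` in the
complement form from losing information. -/
lemma one_sub_le_hockeyStick (α : ℝ≥0) (P Q : Measure E) [IsProbabilityMeasure P]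
    [IsProbabilityMeasure Q] : 1 - α ≤ hockeyStick α P Q := by
  have H0 := testBound_hockeyStick α P Q Set.univ MeasurableSet.univ
  simp only [measure_univ, ENNReal.coe_one, mul_one] at H0
  exact tsub_le_iff_left.mpr H0

/-- Total variation distance bounds the advantage of tests in both directions. -/
lemma testBound_tvd_swap (P Q : Measure E) [IsProbabilityMeasure P] [IsProbabilityMeasure Q] :
    TestBound 1 1 (ENNReal.ofReal (tvd P Q)) Q P := by
  have H := testBound_hockeyStick_swap le_rfl Q P
  rwa [ENNReal.coe_one, tsub_self, tsub_zero, ← ENNReal.ofReal_toReal (ne_top_of_le_ne_top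
    ENNReal.one_ne_top (hockeyStick_le_one 1 P Q))] at H

end TestBound

/-! ### Shifted normal distributions -/

/-- The Neyman–Pearson lemma: it suffices to bound the likelihood ratio test. -/
lemma testBound_withDensity {E : Type*} [MeasurableSpace E] {μ : Measure E} {f g : E → ℝ≥0∞}
    (hf : Measurable f) (hg : Measurable g) {k a : ℝ≥0} {h : ℝ≥0∞}
    [IsFiniteMeasure (μ.withDensity g)]
    (H : k * μ.withDensity f {x | a * g x < k * f x} ≤
      a * μ.withDensity g {x | a * g x < k * f x} + h) :
    TestBound k a h (μ.withDensity f) (μ.withDensity g) := fun S hS => by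
  set A := {x | a * g x < k * f x}
  have hA : MeasurableSet A := measurableSet_lt (hg.const_mul _) (hf.const_mul _)
  have h1 : (k : ℝ≥0∞) * μ.withDensity f (S \ A) ≤ a * μ.withDensity g (S \ A) := by
    rw [withDensity_apply _ (hS.diff hA), withDensity_apply _ (hS.diff hA),
      ← lintegral_const_mul _ hf, ← lintegral_const_mul _ hg]
    exact setLIntegral_mono (hg.const_mul _) fun x hx => not_lt.mp hx.2
  have h2 : (a : ℝ≥0∞) * μ.withDensity g (A \ S) ≤ k * μ.withDensity f (A \ S) := by
    rw [withDensity_apply _ (hA.diff hS), withDensity_apply _ (hA.diff hS),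
      ← lintegral_const_mul _ hf, ← lintegral_const_mul _ hg]
    exact setLIntegral_mono (hf.const_mul _) fun x hx => le_of_lt hx.1
  have hfin : (a : ℝ≥0∞) * μ.withDensity g (A \ S) ≠ ∞ :=
    ENNReal.mul_ne_top ENNReal.coe_ne_top (measure_ne_top _ _)
  -- Removing `A \ S` from the likelihood ratio test can only lower its advantage, since `k f > a g`
  -- there; by `h1`, adding `S \ A` does not raise it.
  have h3 : (k : ℝ≥0∞) * μ.withDensity f (A ∩ S) ≤ a * μ.withDensity g (A ∩ S) + h := by
    refine (ENNReal.add_le_add_iff_right hfin).mp ?_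
    calc (k : ℝ≥0∞) * μ.withDensity f (A ∩ S) + a * μ.withDensity g (A \ S)
        ≤ k * μ.withDensity f (A ∩ S) + k * μ.withDensity f (A \ S) := by gcongr
      _ = k * μ.withDensity f A := by rw [← mul_add, measure_inter_add_sdiff _ hS]
      _ ≤ a * μ.withDensity g A + h := H
      _ = a * μ.withDensity g (A ∩ S) + h + a * μ.withDensity g (A \ S) := by
        rw [← measure_inter_add_sdiff A hS]; ring
  rw [← measure_inter_add_sdiff S hA, ← measure_inter_add_sdiff (μ := μ.withDensity g) S hA,
    Set.inter_comm S A]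
  calc _ = (k : ℝ≥0∞) * μ.withDensity f (A ∩ S) + k * μ.withDensity f (S \ A) := mul_add _ _ _
    _ ≤ (a * μ.withDensity g (A ∩ S) + h) + a * μ.withDensity g (S \ A) := add_le_add h3 h1
    _ = _ := by ring

instance (m s : ℝ) : IsProbabilityMeasure (normal m s) := by
  unfold normal; infer_instance

lemma normal_map_const_mul (c m s : ℝ) : (normal m s).map (c * ·) = normal (c * m) (c * s) := by
  rw [normal, normal, gaussianReal_map_const_mul]
  congr 1
  ext
  simp [mul_pow, sq_nonneg, mul_nonneg]

lemma normal_map_const_add (c m s : ℝ) : (normal m s).map (c + ·) = normal (c + m) s := by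
  rw [normal, normal, gaussianReal_map_const_add, add_comm]

lemma normal_zero (m : ℝ) : normal m 0 = Measure.dirac m := by simp [normal]

lemma normal_Ioi_mono (s c : ℝ) {m m' : ℝ} (hm : m ≤ m') :
    normal m s (Set.Ioi c) ≤ normal m' s (Set.Ioi c) := by
  rw [← sub_add_cancel m' m, ← normal_map_const_add (m' - m) m s,
    Measure.map_apply (measurable_const_add _) measurableSet_Ioi]
  refine measure_mono fun x hx => ?_
  simp only [Set.mem_preimage, Set.mem_Ioi] at hx ⊢
  linarith

/-- Test bounds for a shift of a normal distribution extend to smaller shifts. -/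
lemma TestBound.normal_mono {k a : ℝ≥0} {h : ℝ≥0∞} (hka : k ≤ a) {s m m' : ℝ} (hm : |m| ≤ m')
    (H : TestBound k a h (normal m' s) (normal 0 s)) :
    TestBound k a h (normal m s) (normal 0 s) := by
  -- Negative shifts reduce to positive ones by the reflection `x ↦ -x`.
  wlog hpos : 0 < m generalizing m
  · rcases (not_lt.mp hpos).eq_or_lt with rfl | hneg
    · exact testBound_refl hka _
    · have h1 := this (m := -m) (by rwa [abs_neg]) (by linarith)
      have h2 := h1.map (measurable_const_mul (-1 : ℝ))
      rw [normal_map_const_mul, normal_map_const_mul] at h2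
      simpa [normal] using h2
  rw [abs_of_pos hpos] at hm
  have hIoi : ∀ c, k * normal m s (Set.Ioi c) ≤ a * normal 0 s (Set.Ioi c) + h := fun c =>
    (mul_le_mul_right (normal_Ioi_mono s c hm) _).trans
      (H _ measurableSet_Ioi)
  rcases eq_zero_or_pos k with rfl | hk
  · intro S _; simp
  -- For point masses the half-line above `0` separates `m` from `0`, which forces `k ≤ h`.
  rcases eq_or_ne s 0 with rfl | hs
  · have h1 := hIoi 0
    rw [normal_zero, normal_zero, Measure.dirac_apply' _ measurableSet_Ioi,
      Measure.dirac_apply' _ measurableSet_Ioi] at h1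
    simp only [Set.mem_Ioi, hpos, Set.indicator_of_mem, lt_irrefl, not_false_eq_true,
      Set.indicator_of_notMem, Pi.one_apply, mul_one, mul_zero, zero_add] at h1
    intro S _
    exact le_add_left ((mul_le_of_le_one_right' prob_le_one).trans h1)
  have hv : (s ^ 2).toNNReal ≠ 0 := by simpa using hs
  have ha : 0 < a := hk.trans_le hka
  have hs2 : 0 < s ^ 2 := by positivity
  have e : ∀ b, normal b s = volume.withDensity (gaussianPDF b (s ^ 2).toNNReal) := fun b =>
    gaussianReal_of_var_ne_zero b hv
  have : IsFiniteMeasure (volume.withDensity (gaussianPDF 0 (s ^ 2).toNNReal)) := by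
    rw [← e]; infer_instance
  rw [e, e]
  refine testBound_withDensity (measurable_gaussianPDF _ _) (measurable_gaussianPDF _ _) ?_
  -- The log-likelihood ratio of a shift by `m > 0` is increasing and affine in `x`, so the optimal
  -- test is a half-line, and upper half-lines gain mass as the mean grows.
  have hA : {x | (a : ℝ≥0∞) * gaussianPDF 0 (s ^ 2).toNNReal x <
      k * gaussianPDF m (s ^ 2).toNNReal x} =
      Set.Ioi ((s ^ 2 * (Real.log a - Real.log k) + m ^ 2 / 2) / m) := by
    ext x
    have e1 : ∀ (t : ℝ≥0) (b : ℝ), (t : ℝ≥0∞) * gaussianPDF b (s ^ 2).toNNReal x =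
        ENNReal.ofReal (t * gaussianPDFReal b (s ^ 2).toNNReal x) := fun t b => by
      rw [ENNReal.ofReal_mul t.coe_nonneg, gaussianPDF, ENNReal.ofReal_coe_nnreal]
    have e2 : ∀ (t : ℝ≥0) (b : ℝ), 0 < t → 0 < t * gaussianPDFReal b (s ^ 2).toNNReal x :=
      fun t b ht => mul_pos ht (gaussianPDFReal_pos _ _ _ hv)
    have e3 : ∀ (t : ℝ≥0) (b : ℝ), 0 < t → Real.log (t * gaussianPDFReal b (s ^ 2).toNNReal x) =
        Real.log t + (Real.log (√(2 * Real.pi * s ^ 2))⁻¹ - (x - b) ^ 2 / (2 * s ^ 2)) := by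
      intro t b ht
      have : (0 : ℝ) < t := ht
      rw [gaussianPDFReal, Real.coe_toNNReal _ hs2.le, Real.log_mul this.ne' (by positivity),
        Real.log_mul (by positivity) (Real.exp_ne_zero _), Real.log_exp]
      ring
    rw [Set.mem_ofPred_eq, e1, e1, ENNReal.ofReal_lt_ofReal_iff (e2 k m hk),
      ← Real.log_lt_log_iff (e2 a 0 ha) (e2 k m hk), e3 a 0 ha, e3 k m hk, Set.mem_Ioi,
      div_lt_iff₀ hpos]
    have e4 : (x - m) ^ 2 / (2 * s ^ 2) = ((x - 0) ^ 2 / (2 * s ^ 2)) -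
        (x * m - m ^ 2 / 2) / s ^ 2 := by field_simp; ring
    rw [e4]
    have e5 : s ^ 2 * (Real.log a - Real.log k) + m ^ 2 / 2 < x * m ↔
        Real.log a - Real.log k < (x * m - m ^ 2 / 2) / s ^ 2 := by
      rw [lt_div_iff₀ hs2, lt_sub_iff_add_lt, mul_comm]
    rw [e5]
    constructor <;> intro h <;> linarith
  rw [hA, ← e, ← e]
  exact hIoi _

/-- Scaled form of `TestBound.normal_mono`, for two arbitrary means. -/
lemma TestBound.normal_scale {k a : ℝ≥0} {h : ℝ≥0∞} (hka : k ≤ a) {s m' c b b' : ℝ} (hc : 0 ≤ c)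
    (hb : |b - b'| ≤ c * m') (H : TestBound k a h (normal m' s) (normal 0 s)) :
    TestBound k a h (normal b (s * c)) (normal b' (s * c)) := by
  rcases hc.eq_or_lt with rfl | hc
  · have : b = b' := by simpa [sub_eq_zero] using hb
    exact this ▸ testBound_refl hka _
  have h1 : |(b - b') / c| ≤ m' := by
    rwa [abs_div, abs_of_pos hc, div_le_iff₀ hc, mul_comm]
  have h2 := ((H.normal_mono hka h1).map (measurable_const_mul c)).map (measurable_const_add b')
  rwa [normal_map_const_mul, normal_map_const_mul, normal_map_const_add, normal_map_const_add,
    mul_div_cancel₀ _ hc.ne', mul_zero, add_zero, add_sub_cancel, mul_comm c s] at h2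

lemma pi_normal_map_add {ι : Type*} [Fintype ι] (m : ι → ℝ) (b : ι → ℝ) (s : ℝ) :
    (Measure.pi fun i => normal (b i) s).map (fun z i => m i + z i) =
      Measure.pi fun i => normal (m i + b i) s := by
  rw [Measure.pi_map_pi (f := fun i x => m i + x) fun i => (measurable_const_add _).aemeasurable]
  simp_rw [normal_map_const_add]

/-- Isotropic Gaussian noise has the same form in every orthonormal basis. -/
lemma pi_normal_map_toLp {D : ℕ} (b : OrthonormalBasis (Fin D) ℝ (EuclideanSpace ℝ (Fin D)))
    (s : ℝ) : (Measure.pi fun _ => normal 0 s).map (WithLp.toLp 2) =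
      (Measure.pi fun _ => normal 0 s).map fun z : Fin D → ℝ => ∑ i, z i • b i := by
  have h1 : (Measure.pi fun _ : Fin D => normal 0 s) =
      (Measure.pi fun _ => gaussianReal 0 1).map fun z i => s * z i := by
    have e : gaussianReal 0 1 = normal 0 1 := by simp [normal]
    rw [e, Measure.pi_map_pi (f := fun _ x => s * x)
      fun i => (measurable_const_mul _).aemeasurable]
    simp_rw [normal_map_const_mul, mul_zero, mul_one]
  have h2 := map_pi_eq_stdGaussian (ι := Fin D)
  rw [stdGaussian_eq_map_pi_orthonormalBasis b] at h2
  rw [h1, Measure.map_map (by fun_prop) (by fun_prop), Measure.map_map (by fun_prop) (by fun_prop)]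
  have h3 := congrArg (Measure.map (s • ·)) h2
  rw [Measure.map_map (by fun_prop) (by fun_prop), Measure.map_map (by fun_prop) (by fun_prop)] at h3
  convert h3 using 2
  · rfl
  · ext1 z
    simp [Finset.smul_sum, smul_smul]

/-- Test bounds for translates of isotropic Gaussian noise follow from univariate ones. -/
lemma TestBound.gaussian_translate {D : ℕ} {k a : ℝ≥0} {h : ℝ≥0∞} (hka : k ≤ a) {s m' c : ℝ}
    (hc : 0 ≤ c) (H : TestBound k a h (normal m' s) (normal 0 s)) {w u : EuclideanSpace ℝ (Fin D)}
    (hwu : ‖w - u‖ ≤ c * m') :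
    TestBound k a h
      ((Measure.pi fun _ => normal 0 (s * c)).map fun z : Fin D → ℝ => w + WithLp.toLp 2 z)
      ((Measure.pi fun _ => normal 0 (s * c)).map fun z : Fin D → ℝ => u + WithLp.toLp 2 z) := by
  by_cases hne : w = u
  · exact hne ▸ testBound_refl hka _
  have hpos : 0 < ‖w - u‖ := norm_pos_iff.mpr (sub_ne_zero.mpr hne)
  obtain _ | D := D
  · exact absurd (Subsingleton.elim w u) hne
  -- In an orthonormal basis whose first vector points along `w - u`, the two translates differ in
  -- the mean of one coordinate only.
  obtain ⟨b, hb⟩ := Orthonormal.exists_orthonormalBasis_extension_of_card_eq (𝕜 := ℝ)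
    (E := EuclideanSpace ℝ (Fin (D + 1))) (ι := Fin (D + 1)) (by simp)
    (v := fun _ => ‖w - u‖⁻¹ • (w - u)) (s := {0})
    ⟨fun i => by simp [norm_smul, hpos.ne'],
      fun i j hij => absurd (Subsingleton.elim i j) hij⟩
  have hb0 : ‖w - u‖ • b 0 = w - u := by
    rw [hb 0 rfl, smul_smul, mul_inv_cancel₀ hpos.ne', one_smul]
  set m : Fin (D + 1) → ℝ := Pi.single 0 ‖w - u‖ with hm
  have hu : ∀ x : EuclideanSpace ℝ (Fin (D + 1)), (Measure.pi fun _ => normal 0 (s * c)).map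
      (fun z : Fin (D + 1) → ℝ => x + WithLp.toLp 2 z) =
      (Measure.pi fun _ => normal 0 (s * c)).map (fun z => x + ∑ i, z i • b i) := fun x => by
    have := congrArg (Measure.map (x + ·)) (pi_normal_map_toLp b (s * c))
    rwa [Measure.map_map (by fun_prop) (by fun_prop),
      Measure.map_map (by fun_prop) (by fun_prop)] at this
  have hw : (Measure.pi fun _ => normal 0 (s * c)).map (fun z => w + ∑ i, z i • b i) =
      (Measure.pi fun i => normal (m i) (s * c)).map (fun z => u + ∑ i, z i • b i) := by
    have := pi_normal_map_add m 0 (s * c)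
    simp only [Pi.zero_apply, add_zero] at this
    rw [← this, Measure.map_map (by fun_prop) (by fun_prop)]
    congr 1
    ext1 z
    have e : ∑ i, m i • b i = w - u := by
      rw [Finset.sum_eq_single 0 (fun i _ hi => by simp [hm, hi]) (by simp), ← hb0]
      simp [hm]
    simp only [Function.comp_apply, add_smul, Finset.sum_add_distrib, e]
    abel
  rw [hu, hu, hw]
  refine TestBound.map (TestBound.pi 0 ?_ fun i hi => by simp [hm, hi]) (by fun_prop)
  refine H.normal_scale hka hc ?_
  simpa [hm] using hwu


/-! ### Uniform mixtures -/

section Mixture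

variable {ι E F : Type*} [Fintype ι] [MeasurableSpace E] [MeasurableSpace F]

lemma uniformMixture_apply (μ : ι → Measure E) (S : Set E) :
    uniformMixture μ S = (Fintype.card ι : ℝ≥0∞)⁻¹ * ∑ i, μ i S := by
  simp [uniformMixture]

lemma card_inv_mul_card [Nonempty ι] : (Fintype.card ι : ℝ≥0∞)⁻¹ * Fintype.card ι = 1 :=
  ENNReal.inv_mul_cancel (by simp) (ENNReal.natCast_ne_top _)

instance [Nonempty ι] (μ : ι → Measure E) [∀ i, IsProbabilityMeasure (μ i)] :
    IsProbabilityMeasure (uniformMixture μ) :=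
  ⟨by simp [uniformMixture_apply, card_inv_mul_card]⟩

lemma uniformMixture_map (μ : ι → Measure E) {f : E → F} (hf : Measurable f) :
    (uniformMixture μ).map f = uniformMixture fun i => (μ i).map f := by
  ext S hS
  simp [Measure.map_apply hf hS, uniformMixture_apply]

lemma uniformMixture_prod (μ : ι → Measure E) (ν : Measure F) [∀ i, SFinite (μ i)] [SFinite ν] :
    (uniformMixture μ).prod ν = uniformMixture fun i => (μ i).prod ν := by
  rw [uniformMixture, uniformMixture, Measure.prod_smul_left, ← Measure.sum_fintype,
    Measure.prod_sum_left, Measure.sum_fintype]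

lemma uniformMixture_fst_snd {κ : Type*} [Fintype κ] (μ : ι × κ → Measure E) :
    uniformMixture μ = uniformMixture fun i => uniformMixture fun j => μ (i, j) := by
  ext S _
  simp only [uniformMixture_apply, Fintype.card_prod, Fintype.sum_prod_type, Finset.mul_sum]
  rw [Nat.cast_mul, ENNReal.mul_inv (by simp) (by simp)]
  simp only [mul_assoc]

/-- Independent mixtures form a mixture over all joint choices. -/
lemma pi_uniformMixture {n : ℕ} {κ : Type*} [Fintype κ] [Nonempty κ] (μ : Fin n → κ → Measure E)
    [∀ i j, IsProbabilityMeasure (μ i j)] :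
    Measure.pi (fun i => uniformMixture (μ i)) =
      uniformMixture fun t : Fin n → κ => Measure.pi fun i => μ i (t i) := by
  classical
  refine Measure.pi_eq fun s hs => ?_
  simp only [uniformMixture_apply, Measure.pi_pi, Finset.prod_mul_distrib, Finset.prod_univ_sum,
    Fintype.piFinset_univ, Finset.prod_const, Finset.card_univ, Fintype.card_fin, Fintype.card_pi]
  rw [Nat.cast_pow, ENNReal.inv_pow]

lemma TestBound.uniformMixture [Nonempty ι] {k a : ℝ≥0} {h : ι → ℝ≥0∞} {P Q : ι → Measure E}
    (H : ∀ i, TestBound k a (h i) (P i) (Q i)) :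
    TestBound k a ((Fintype.card ι : ℝ≥0∞)⁻¹ * ∑ i, h i)
      (uniformMixture P) (uniformMixture Q) := fun S hS => by
  rw [uniformMixture_apply, uniformMixture_apply, mul_left_comm, mul_left_comm (a : ℝ≥0∞),
    ← mul_add, Finset.mul_sum (a := (k : ℝ≥0∞)), Finset.mul_sum (a := (a : ℝ≥0∞)),
    ← Finset.sum_add_distrib]
  gcongr with i
  exact H i S hS

lemma ae_uniformMixture {μ : ι → Measure E} {p : E → Prop} (h : ∀ i, ∀ᵐ x ∂μ i, p x) :
    ∀ᵐ x ∂uniformMixture μ, p x := by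
  rw [ae_iff, uniformMixture_apply, Finset.sum_eq_zero fun i _ => ae_iff.mp (h i), mul_zero]

end Mixture

/-! ### Factorization of the training step -/

section Step

variable {L LC LF D N lam : ℕ}

/-- The law of the contribution of the series `a` to the sum of clipped gradients, if `G` maps
noisy context and forecast windows to clipped gradients. -/
noncomputable def seriesLaw (lam : ℕ) (G : (Fin LC → ℝ) → (Fin LF → ℝ) → EuclideanSpace ℝ (Fin D))
    (sC sF : ℝ) (a : Fin L → ℝ) : Measure (EuclideanSpace ℝ (Fin D)) :=
  uniformMixture fun t : Fin lam → Fin (L + 1 - LF) =>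
    Measure.map
      (fun z : (Fin lam → Fin LC → ℝ) × (Fin lam → Fin LF → ℝ) =>
        ∑ j, G (contextWindow (subsequence LC LF a (t j)) + z.1 j)
          (forecastWindow (subsequence LC LF a (t j)) + z.2 j))
      ((Measure.pi fun _ => Measure.pi fun _ => normal 0 sC).prod
        (Measure.pi fun _ => Measure.pi fun _ => normal 0 sF))

variable {G : (Fin LC → ℝ) → (Fin LF → ℝ) → EuclideanSpace ℝ (Fin D)}

lemma measurable_sum_gradient (hG : Measurable (Function.uncurry G))
    (yC : Fin lam → Fin LC → ℝ) (yF : Fin lam → Fin LF → ℝ) :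
    Measurable fun z : (Fin lam → Fin LC → ℝ) × (Fin lam → Fin LF → ℝ) =>
      ∑ j, G (yC j + z.1 j) (yF j + z.2 j) :=
  Finset.measurable_sum _ fun j _ =>
    hG.comp (f := fun z : (Fin lam → Fin LC → ℝ) × (Fin lam → Fin LF → ℝ) =>
      (yC j + z.1 j, yF j + z.2 j)) (by fun_prop)

lemma isProbabilityMeasure_seriesLaw (hG : Measurable (Function.uncurry G)) (hL : LF ≤ L)
    (sC sF : ℝ) (a : Fin L → ℝ) : IsProbabilityMeasure (seriesLaw lam G sC sF a) := by
  have : Nonempty (Fin (L + 1 - LF)) := ⟨⟨0, by omega⟩⟩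
  have (t : Fin lam → Fin (L + 1 - LF)) := Measure.isProbabilityMeasure_map
    (μ := (Measure.pi fun _ => Measure.pi fun _ => normal 0 sC).prod
        (Measure.pi fun _ => Measure.pi fun _ => normal 0 sF))
    (measurable_sum_gradient hG
    (fun j => contextWindow (subsequence LC LF a (t j)))
    (fun j => forecastWindow (subsequence LC LF a (t j)))).aemeasurable
  unfold seriesLaw
  infer_instance

/-- The sum of clipped gradients with independent series contributions and additive noise. -/
noncomputable def noisySumLaw {n : ℕ} (ν : Fin n → Measure (EuclideanSpace ℝ (Fin D))) (s : ℝ) :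
    Measure (EuclideanSpace ℝ (Fin D)) :=
  ((Measure.pi ν).prod (Measure.pi fun _ => normal 0 s)).map
    fun q : (Fin n → EuclideanSpace ℝ (Fin D)) × (Fin D → ℝ) => ∑ i, q.1 i + WithLp.toLp 2 q.2

lemma measurable_noisySum {n : ℕ} : Measurable
    fun q : (Fin n → EuclideanSpace ℝ (Fin D)) × (Fin D → ℝ) => ∑ i, q.1 i + WithLp.toLp 2 q.2 := by
  fun_prop

instance {n : ℕ} (ν : Fin n → Measure (EuclideanSpace ℝ (Fin D)))
    [∀ i, IsProbabilityMeasure (ν i)] (s : ℝ) : IsProbabilityMeasure (noisySumLaw ν s) :=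
  Measure.isProbabilityMeasure_map measurable_noisySum.aemeasurable

lemma noisySumLaw_apply {n : ℕ} (ν : Fin n → Measure (EuclideanSpace ℝ (Fin D)))
    [∀ i, IsProbabilityMeasure (ν i)] (s : ℝ) {S : Set (EuclideanSpace ℝ (Fin D))}
    (hS : MeasurableSet S) : noisySumLaw ν s S = ∫⁻ c, ((Measure.pi fun _ => normal 0 s).map
      fun z : Fin D → ℝ => (∑ i, c i) + WithLp.toLp 2 z) S ∂Measure.pi ν := by
  rw [noisySumLaw, Measure.map_apply measurable_noisySum hS,
    Measure.prod_apply (measurable_noisySum hS)]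
  refine lintegral_congr fun c => ?_
  rw [Measure.map_apply (by fun_prop) hS]
  rfl

lemma noisySumLaw_uniformMixture {n : ℕ} {κ : Type*} [Fintype κ] [Nonempty κ]
    (μ : Fin n → κ → Measure (EuclideanSpace ℝ (Fin D))) [∀ i j, IsProbabilityMeasure (μ i j)]
    (s : ℝ) : noisySumLaw (fun i => uniformMixture (μ i)) s =
      uniformMixture fun t : Fin n → κ => noisySumLaw (fun i => μ i (t i)) s := by
  rw [noisySumLaw, pi_uniformMixture, uniformMixture_prod, uniformMixture_map _ measurable_noisySum]
  rfl

/-- Only the grouping of the noise changes: one pair (context noise, forecast noise) per series on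
the left, all context noise and then all forecast noise on the right, as in `stepLaw`. -/
lemma noisySumLaw_map {n : ℕ} {A B : Type*} [MeasurableSpace A] [MeasurableSpace B]
    (μ : Measure A) (ν : Measure B) [IsProbabilityMeasure μ] [IsProbabilityMeasure ν]
    {c : Fin n → A × B → EuclideanSpace ℝ (Fin D)} (hc : ∀ i, Measurable (c i)) (s : ℝ) :
    noisySumLaw (fun i => (μ.prod ν).map (c i)) s =
      ((Measure.pi fun _ => μ).prod ((Measure.pi fun _ => ν).prod
        (Measure.pi fun _ => normal 0 s))).map
          fun Z : (Fin n → A) × (Fin n → B) × (Fin D → ℝ) =>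
            ∑ i, c i (Z.1 i, Z.2.1 i) + WithLp.toLp 2 Z.2.2 := by
  have (i : Fin n) : IsProbabilityMeasure ((μ.prod ν).map (c i)) :=
    Measure.isProbabilityMeasure_map (hc i).aemeasurable
  have hc' : Measurable fun (x : Fin n → A × B) i => c i (x i) :=
    measurable_pi_lambda _ fun i => (hc i).comp (measurable_pi_apply i)
  have h1 := (measurePreserving_arrowProdEquivProdArrow A B (Fin n) (fun _ => μ)
    (fun _ => ν)).map_eq
  have h2 := (measurePreserving_prodAssoc (Measure.pi fun _ : Fin n => μ)
    (Measure.pi fun _ : Fin n => ν) (Measure.pi fun _ : Fin D => normal 0 s)).map_eq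
  have hsum : Measurable fun Z : (Fin n → A) × (Fin n → B) × (Fin D → ℝ) =>
      ∑ i, c i (Z.1 i, Z.2.1 i) + WithLp.toLp 2 Z.2.2 :=
    (Finset.measurable_sum _ fun i _ => (hc i).comp (by fun_prop)).add (by fun_prop)
  rw [noisySumLaw, ← Measure.pi_map_pi fun i => (hc i).aemeasurable, ← h2, ← h1,
    Measure.map_map hsum (MeasurableEquiv.measurable _)]
  have h3 := Measure.map_prod_map (Measure.pi fun _ : Fin n => μ.prod ν)
    (Measure.pi fun _ : Fin D => normal 0 s)
    (MeasurableEquiv.arrowProdEquivProdArrow A B (Fin n)).measurable measurable_id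
  have h4 := Measure.map_prod_map (Measure.pi fun _ : Fin n => μ.prod ν)
    (Measure.pi fun _ : Fin D => normal 0 s) hc' measurable_id
  rw [Measure.map_id] at h3 h4
  rw [h3, h4, Measure.map_map measurable_noisySum (hc'.prodMap measurable_id),
    Measure.map_map (hsum.comp (MeasurableEquiv.measurable _))
      ((MeasurableEquiv.measurable _).prodMap measurable_id)]
  rfl

/-- The training step is a post-processing of noisy sums of independent contributions. -/
lemma stepLaw_eq {O : Type*} {Λ : ℕ} (hN : Λ / lam ≤ N) (hL : LF ≤ L)
    (f : EuclideanSpace ℝ (Fin D) → (Fin LC → ℝ) → O) (ℓ : O → (Fin LF → ℝ) → ℝ)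
    (θ : EuclideanSpace ℝ (Fin D)) (η σ C σC σF v : ℝ)
    (hG : Measurable (Function.uncurry fun c z => clip C (lossGradient f ℓ θ c z)))
    (x : Fin N → Fin L → ℝ) :
    stepLaw lam Λ hN f ℓ θ η σ C σC σF v x =
      (uniformMixture fun π : Equiv.Perm (Fin N) => noisySumLaw (fun i : Fin (Λ / lam) =>
        seriesLaw lam (fun c z => clip C (lossGradient f ℓ θ c z)) (σC * v) (σF * v)
          (x (π (Fin.castLE hN i)))) (σ * C)).map fun w => θ - η • ((1 / (Λ : ℝ)) • w) := by
  have : Nonempty (Fin (L + 1 - LF)) := ⟨⟨0, by omega⟩⟩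
  have hpost : Measurable fun w : EuclideanSpace ℝ (Fin D) => θ - η • ((1 / (Λ : ℝ)) • w) := by
    fun_prop
  rw [uniformMixture_map _ hpost, stepLaw, uniformMixture_fst_snd]
  congr 1
  ext1 π
  have hc := fun (i : Fin (Λ / lam)) (t : Fin lam → Fin (L + 1 - LF)) =>
    measurable_sum_gradient hG
      (fun j => contextWindow (subsequence LC LF (x (π (Fin.castLE hN i))) (t j)))
      (fun j => forecastWindow (subsequence LC LF (x (π (Fin.castLE hN i))) (t j)))
  have hprob := fun i t => Measure.isProbabilityMeasure_map
    (μ := (Measure.pi fun _ => Measure.pi fun _ => normal 0 (σC * v)).prod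
        (Measure.pi fun _ => Measure.pi fun _ => normal 0 (σF * v))) (hc i t).aemeasurable
  simp only [seriesLaw]
  -- The start positions are independent across series, so averaging over their joint choice is the
  -- same as mixing within each series.
  rw [noisySumLaw_uniformMixture (fun (i : Fin (Λ / lam)) t => Measure.map _ _),
    uniformMixture_map _ hpost]
  congr 1
  ext1 t
  rw [noisySumLaw_map _ _ fun i => hc i (t i), Measure.map_map hpost]
  · rfl
  · exact (Finset.measurable_sum _ fun i _ => (hc i (t i)).comp (by fun_prop)).add (by fun_prop)

end Step


/-! ### Sensitivity of the law of a single series -/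

section Series

variable {L LC LF D : ℕ} {G : (Fin LC → ℝ) → (Fin LF → ℝ) → EuclideanSpace ℝ (Fin D)}

lemma seriesLaw_ae_norm_le (lam : ℕ) (hG : Measurable (Function.uncurry G)) {C : ℝ}
    (hC : ∀ c z, ‖G c z‖ ≤ C) (sC sF : ℝ) (a : Fin L → ℝ) :
    ∀ᵐ g ∂seriesLaw lam G sC sF a, ‖g‖ ≤ lam * C := by
  refine ae_uniformMixture fun t => ?_
  rw [ae_map_iff (measurable_sum_gradient hG _ _).aemeasurable
    (measurableSet_le measurable_norm measurable_const)]
  filter_upwards with z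
  refine (norm_sum_le _ _).trans ((Finset.sum_le_sum fun j _ => hC _ _).trans_eq ?_)
  simp

lemma norm_clip_le {C : ℝ} (hC : 0 < C) (g : EuclideanSpace ℝ (Fin D)) : ‖clip C g‖ ≤ C := by
  have h1 : 0 < max 1 (‖g‖ / C) := lt_max_of_lt_left one_pos
  rw [clip, norm_smul, norm_inv, Real.norm_of_nonneg h1.le, inv_mul_le_iff₀ h1]
  calc ‖g‖ = ‖g‖ / C * C := (div_mul_cancel₀ _ hC.ne').symm
    _ ≤ _ := by gcongr; exact le_max_right _ _

/-- Adding constants to the noise of the windows amounts to shifting its means. -/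
lemma map_add_pi_normal {lam m : ℕ} (y : Fin lam → Fin m → ℝ) (s : ℝ) :
    (Measure.pi fun _ => Measure.pi fun _ => normal 0 s).map (fun z => y + z) =
      Measure.pi fun j => Measure.pi fun i => normal (y j i) s := by
  have := Measure.pi_map_pi (μ := fun _ : Fin lam => Measure.pi fun _ : Fin m => normal 0 s)
    (f := fun j z => y j + z) fun j => (measurable_const_add _).aemeasurable
  refine this.trans ?_
  congr 1
  ext1 j
  have := pi_normal_map_add (y j) 0 s
  simp only [Pi.zero_apply, add_zero] at this
  exact this

/-- Moving the windows into the means of the noise leaves `G` as a post-processing that does not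
depend on the data. -/
lemma gradientLaw_eq {lam : ℕ} (hG : Measurable (Function.uncurry G)) (sC sF : ℝ)
    (yC : Fin lam → Fin LC → ℝ) (yF : Fin lam → Fin LF → ℝ) :
    ((Measure.pi fun _ => Measure.pi fun _ => normal 0 sC).prod
        (Measure.pi fun _ => Measure.pi fun _ => normal 0 sF)).map
      (fun z : (Fin lam → Fin LC → ℝ) × (Fin lam → Fin LF → ℝ) =>
        ∑ j, G (yC j + z.1 j) (yF j + z.2 j)) =
    ((Measure.pi fun j => Measure.pi fun i => normal (yC j i) sC).prod
        (Measure.pi fun j => Measure.pi fun i => normal (yF j i) sF)).map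
      (fun z : (Fin lam → Fin LC → ℝ) × (Fin lam → Fin LF → ℝ) => ∑ j, G (z.1 j) (z.2 j)) := by
  have h0 : Measurable fun z : (Fin lam → Fin LC → ℝ) × (Fin lam → Fin LF → ℝ) =>
      ∑ j, G (z.1 j) (z.2 j) := by
    simpa using measurable_sum_gradient hG (0 : Fin lam → Fin LC → ℝ) (0 : Fin lam → Fin LF → ℝ)
  rw [← map_add_pi_normal yC, ← map_add_pi_normal yF,
    Measure.map_prod_map _ _ (measurable_const_add _) (measurable_const_add _),
    Measure.map_map h0 ((measurable_const_add _).prodMap (measurable_const_add _))]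
  rfl

/-- Changing one entry of a subsequence by at most `v` is a test bounded change of the law of its
gradient. -/
lemma testBound_gradientLaw (hG : Measurable (Function.uncurry G)) {s v : ℝ} (hv : 0 ≤ v)
    {y y' : Fin (LC + LF) → ℝ} (u : Fin (LC + LF)) (hne : ∀ i, i ≠ u → y i = y' i)
    (hu : |y u - y' u| ≤ v) :
    TestBound 1 1 (ENNReal.ofReal (tvd (normal 0 s) (normal 1 s)))
      (((Measure.pi fun _ : Fin 1 => Measure.pi fun i => normal (contextWindow y i) (s * v)).prod
        (Measure.pi fun _ => Measure.pi fun i => normal (forecastWindow y i) (s * v))).map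
          fun z => ∑ j, G (z.1 j) (z.2 j))
      (((Measure.pi fun _ : Fin 1 => Measure.pi fun i => normal (contextWindow y' i) (s * v)).prod
        (Measure.pi fun _ => Measure.pi fun i => normal (forecastWindow y' i) (s * v))).map
          fun z => ∑ j, G (z.1 j) (z.2 j)) := by
  have h0 : Measurable fun z : (Fin 1 → Fin LC → ℝ) × (Fin 1 → Fin LF → ℝ) =>
      ∑ j, G (z.1 j) (z.2 j) := by
    simpa using measurable_sum_gradient hG (0 : Fin 1 → Fin LC → ℝ) (0 : Fin 1 → Fin LF → ℝ)
  refine TestBound.map ?_ h0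
  -- The same bound serves both windows, because context and forecast noise have equal levels. The
  -- scale factor is `v`: a shift by at most `v` at level `s * v` is a shift by at most `1` at level
  -- `s`.
  have H := (testBound_tvd_swap (normal 0 s) (normal 1 s)).normal_scale le_rfl hv
    (hu.trans_eq (mul_one v).symm)
  induction u using Fin.addCases with
  | left u =>
    have e : forecastWindow y = forecastWindow y' := funext fun i => hne _ fun h => by
      have := congrArg Fin.val h
      simp at this
      omega
    rw [e]
    refine TestBound.prod_right (TestBound.pi 0 (TestBound.pi u H fun i hi => ?_)
      fun i hi => absurd (Subsingleton.elim i 0) hi) _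
    rw [contextWindow, contextWindow, hne _ fun h => hi (Fin.castAdd_injective _ _ h)]
  | right u =>
    have e : contextWindow y = contextWindow y' := funext fun i => hne _ fun h => by
      have := congrArg Fin.val h
      simp at this
      omega
    rw [e]
    refine TestBound.prod_left (TestBound.pi 0 (TestBound.pi u H fun i hi => ?_)
      fun i hi => absurd (Subsingleton.elim i 0) hi) _
    rw [forecastWindow, forecastWindow, hne _ fun h => hi (Fin.natAdd_injective _ _ h)]

lemma append_zero_eq {a a' : Fin L → ℝ} {u : Fin L} (hne : ∀ i, i ≠ u → a i = a' i)
    (i : Fin (LC + L)) (hi : (i : ℕ) ≠ LC + u) :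
    Fin.append (0 : Fin LC → ℝ) a i = Fin.append (0 : Fin LC → ℝ) a' i := by
  induction i using Fin.addCases with
  | left i => simp
  | right i =>
    rw [Fin.append_right, Fin.append_right]
    exact hne i fun h => hi (by simp [h])

/-- At most `LC + LF` of the windows contain a given position. -/
lemma card_window_le (m p T : ℕ) :
    (Finset.univ.filter fun t : Fin 1 → Fin T => ∃ k : Fin m, (t 0 : ℕ) + k = p).card ≤ m := by
  calc _ ≤ (Finset.univ : Finset (Fin m)).card := by
        refine Finset.card_le_card_of_forall_subsingleton
          (fun (t : Fin 1 → Fin T) (k : Fin m) => (t 0 : ℕ) + k = p) ?_ ?_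
        · intro t ht
          obtain ⟨k, hk⟩ := (Finset.mem_filter.mp ht).2
          exact ⟨k, Finset.mem_univ _, hk⟩
        · rintro k - t ⟨-, ht⟩ t' ⟨-, ht'⟩
          ext i
          rw [Subsingleton.elim i 0]
          omega
    _ = m := by simp

/-- Condition on the start position. A window without the changed entry, which sits at position `LC
+ u` of the padded series, contributes nothing; each of the at most `LC + LF` others contributes at
most the total variation distance. -/
lemma testBound_seriesLaw (hG : Measurable (Function.uncurry G)) (hL : LF ≤ L) (s : ℝ) {v : ℝ}
    (hv : 0 ≤ v) {a a' : Fin L → ℝ} (u : Fin L) (hne : ∀ i, i ≠ u → a i = a' i)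
    (hu : |a u - a' u| ≤ v) :
    TestBound 1 1 (ENNReal.ofReal
      (((LC : ℝ) + LF) / ((L : ℝ) - LF + 1) * tvd (normal 0 s) (normal 1 s)))
      (seriesLaw 1 G (s * v) (s * v) a) (seriesLaw 1 G (s * v) (s * v) a') := by
  classical
  have : Nonempty (Fin (L + 1 - LF)) := ⟨⟨0, by omega⟩⟩
  set τ := tvd (normal 0 s) (normal 1 s)
  have hτ : 0 ≤ τ := tvd_nonneg _ _
  set p : (Fin 1 → Fin (L + 1 - LF)) → Prop :=
    fun t => ∃ k : Fin (LC + LF), (t 0 : ℕ) + k = LC + u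
  have H : TestBound 1 1 _ (seriesLaw 1 G (s * v) (s * v) a) (seriesLaw 1 G (s * v) (s * v) a') :=
    TestBound.uniformMixture (h := fun t => if p t then ENNReal.ofReal τ else 0) fun t => by
      have e1 : ∀ j, t j = t 0 := fun j => by rw [Subsingleton.elim j 0]
      simp only [gradientLaw_eq hG, e1]
      by_cases ht : p t
      · rw [if_pos ht]
        obtain ⟨k, hk⟩ := ht
        refine testBound_gradientLaw hG hv k (fun i hi => append_zero_eq hne _ fun h => hi ?_) ?_
        · exact Fin.ext (by simp at h; omega)
        · have e2 : (⟨t 0 + k, by omega⟩ : Fin (LC + L)) = Fin.natAdd LC u := Fin.ext hk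
          simp only [subsequence, e2, Fin.append_right]
          exact hu
      · rw [if_neg ht]
        have e2 : subsequence LC LF a (t 0) = subsequence LC LF a' (t 0) :=
          funext fun k => append_zero_eq hne _ fun h => ht ⟨k, h⟩
        rw [e2]
        exact testBound_refl le_rfl _
  refine fun S hS => (H S hS).trans (add_le_add_right ?_ _)
  have hT : (0 : ℝ) < (L : ℝ) - LF + 1 := by
    have : (LF : ℝ) ≤ L := by exact_mod_cast hL
    linarith
  have e3 : ((L + 1 - LF : ℕ) : ℝ) = (L : ℝ) - LF + 1 := by
    rw [Nat.cast_sub (by omega)]; push_cast; ring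
  rw [← Finset.sum_filter, Finset.sum_const, nsmul_eq_mul, Fintype.card_fun, Fintype.card_fin,
    Fintype.card_fin, pow_one, mul_comm, ← div_eq_mul_inv]
  refine ENNReal.div_le_of_le_mul ?_
  rw [← ENNReal.ofReal_natCast (L + 1 - LF), e3, ← ENNReal.ofReal_mul (by positivity),
    mul_right_comm, div_mul_cancel₀ _ hT.ne', ENNReal.ofReal_mul (by positivity),
    ← Nat.cast_add, ENNReal.ofReal_natCast]
  gcongr
  exact card_window_le _ _ _

/-- Replacing the law `P` by `Q` changes the mean of a function with values in `[m, M]` by at most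
`M - m` times the advantage of tests. -/
lemma TestBound.lintegral_le {E : Type*} [MeasurableSpace E] {P Q : Measure E}
    [IsProbabilityMeasure P] [IsProbabilityMeasure Q] {h : ℝ≥0∞} (H : TestBound 1 1 h P Q)
    {ψ : E → ℝ≥0∞} (hψ : Measurable ψ) {m M : ℝ≥0∞} (hM : M ≠ ∞)
    (hP : ∀ᵐ x ∂P, m ≤ ψ x ∧ ψ x ≤ M) (hQ : ∀ᵐ x ∂Q, m ≤ ψ x ∧ ψ x ≤ M) :
    ∫⁻ x, ψ x ∂P ≤ ∫⁻ x, ψ x ∂Q + h * (M - m) := by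
  set δ : ℝ := (M - m).toReal
  have hδ : M - m ≠ ∞ := ENNReal.sub_ne_top hM
  set g : E → ℝ := fun x => (ψ x - m).toReal
  have hg : Measurable g := (hψ.sub_const m).ennreal_toReal
  have hg0 : ∀ x, 0 ≤ g x := fun x => ENNReal.toReal_nonneg
  -- Layer cake formula for `ψ - m`, whose level sets are tests.
  have key : ∀ (ρ : Measure E) [IsProbabilityMeasure ρ], (∀ᵐ x ∂ρ, m ≤ ψ x ∧ ψ x ≤ M) →
      ∫⁻ x, ψ x ∂ρ = m + ∫⁻ t in Set.Ioi 0, ρ {x | t ≤ g x} := by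
    intro ρ _ hR
    rw [← lintegral_eq_lintegral_meas_le ρ (Filter.Eventually.of_forall hg0) hg.aemeasurable]
    have : ∫⁻ _, m ∂ρ = m := by simp
    conv_rhs => rw [← this]
    rw [← lintegral_add_left measurable_const]
    refine lintegral_congr_ae ?_
    filter_upwards [hR] with x hx
    rw [ENNReal.ofReal_toReal (ENNReal.sub_ne_top (ne_top_of_le_ne_top hM hx.2)),
      add_tsub_cancel_of_le hx.1]
  rw [key P hP, key Q hQ, add_assoc]
  gcongr
  -- Levels up to `M - m` cost at most `h` each; higher level sets are `P`-null.
  have hle : ∀ t : ℝ, P {x | t ≤ g x} ≤ Q {x | t ≤ g x} + (Set.Iic δ).indicator (fun _ => h) t := by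
    intro t
    by_cases ht : t ≤ δ
    · have := H {x | t ≤ g x} (measurableSet_le measurable_const hg)
      rw [Set.indicator_of_mem (by exact ht)]
      simpa using this
    · have : P {x | t ≤ g x} = 0 := by
        refine measure_mono_null (t := {x | ¬ (m ≤ ψ x ∧ ψ x ≤ M)}) (fun x hx hx' => ht ?_) hP
        exact le_trans hx (ENNReal.toReal_mono hδ (tsub_le_tsub_right hx'.2 m))
      simp [this]
  refine (lintegral_mono fun t => hle t).trans_eq ?_
  rw [lintegral_add_right _ (measurable_const.indicator measurableSet_Iic)]
  congr 1
  rw [lintegral_indicator measurableSet_Iic, Measure.restrict_restrict measurableSet_Iic,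
    setLIntegral_const, Set.inter_comm, Set.Ioi_inter_Iic, Real.volume_Ioc, sub_zero,
    ENNReal.ofReal_toReal hδ]

end Series

/-! ### Sampling without replacement -/

/-- Summing over all permutations `π`, with `n` either at a position `k < N'` or swapped out of
it. -/
lemma sum_perm_eq {N N' : ℕ} (hN : N' ≤ N) (n : Fin N) (q : Equiv.Perm (Fin N) → ℝ≥0∞) :
    N' * ∑ π, q π = ∑ k : Fin N', ∑ π : Equiv.Perm (Fin N) with π (Fin.castLE hN k) = n,
      (N' * q π + ∑ l ∈ Finset.univ.filter (fun l : Fin N => N' ≤ l), q (π * Equiv.swap (Fin.castLE hN k) l)) := by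
  classical
  have h1 : ∑ π, q π = ∑ l : Fin N, ∑ π : Equiv.Perm (Fin N) with π l = n, q π := by
    rw [← Finset.sum_fiberwise Finset.univ (fun π : Equiv.Perm (Fin N) => π.symm n) q]
    refine Finset.sum_congr rfl fun l _ => Finset.sum_congr (Finset.filter_congr fun π _ => ?_)
      fun _ _ => rfl
    rw [Equiv.symm_apply_eq, eq_comm]
  have h2 : ∑ l : Fin N, ∑ π : Equiv.Perm (Fin N) with π l = n, q π =
      (∑ k : Fin N', ∑ π : Equiv.Perm (Fin N) with π (Fin.castLE hN k) = n, q π) +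
        ∑ l ∈ Finset.univ.filter (fun l : Fin N => N' ≤ l), ∑ π : Equiv.Perm (Fin N) with π l = n, q π := by
    rw [← Finset.sum_filter_not_add_sum_filter Finset.univ (fun l : Fin N => N' ≤ (l : ℕ))]
    congr 1
    refine (Finset.sum_nbij (Fin.castLE hN) ?_ ?_ ?_ ?_).symm
    · intro k _; simp
    · exact fun _ _ _ _ h => Fin.castLE_injective hN h
    · intro l hl
      simp only [Finset.coe_filter, Finset.mem_univ, true_and, not_le, Set.mem_ofPred_eq] at hl
      exact ⟨⟨l, hl⟩, by simp, rfl⟩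
    · intro _ _; rfl
  -- Precomposing with the transposition of positions `k` and `l` is a bijection between the
  -- permutations with `n` at `l` and those with `n` at `k`.
  have h3 : ∀ (k : Fin N') (l : Fin N),
      ∑ π : Equiv.Perm (Fin N) with π l = n, q π =
        ∑ π : Equiv.Perm (Fin N) with π (Fin.castLE hN k) = n,
          q (π * Equiv.swap (Fin.castLE hN k) l) := by
    intro k l
    refine Finset.sum_nbij' (· * Equiv.swap (Fin.castLE hN k) l)
      (· * Equiv.swap (Fin.castLE hN k) l) ?_ ?_ ?_ ?_ ?_
    · intro π hπ
      simpa using hπ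
    · intro π hπ
      simpa using hπ
    · intro π _; simp [mul_assoc]
    · intro π _; simp [mul_assoc]
    · intro π _; simp [mul_assoc]
  simp only [Finset.sum_add_distrib, ← Finset.mul_sum]
  rw [h1, h2, mul_add]
  congr 1
  -- The factor `N'` supplies one copy of each batch without `n` for every position `k` into which
  -- `n` could be exchanged.
  calc (N' : ℝ≥0∞) * ∑ l ∈ Finset.univ.filter (fun l : Fin N => N' ≤ l), ∑ π : Equiv.Perm (Fin N) with π l = n, q π
      = ∑ k : Fin N', ∑ l ∈ Finset.univ.filter (fun l : Fin N => N' ≤ l),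
          ∑ π : Equiv.Perm (Fin N) with π l = n, q π := by simp
    _ = _ := by
      refine Finset.sum_congr rfl fun k _ => ?_
      rw [Finset.sum_comm]
      exact Finset.sum_congr rfl fun l _ => h3 k l


section Exchange

variable {D : ℕ}

lemma lintegral_pi_sum {n : ℕ} (μ : Fin (n + 1) → Measure (EuclideanSpace ℝ (Fin D)))
    [∀ i, IsProbabilityMeasure (μ i)] (k : Fin (n + 1)) {Φ : EuclideanSpace ℝ (Fin D) → ℝ≥0∞}
    (hΦ : Measurable Φ) :
    ∫⁻ c, Φ (∑ i, c i) ∂Measure.pi μ =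
      ∫⁻ r, ∫⁻ c, Φ (c + ∑ i, r i) ∂μ k ∂Measure.pi fun i => μ (k.succAbove i) := by
  have hm : Measurable fun q : EuclideanSpace ℝ (Fin D) × (Fin n → EuclideanSpace ℝ (Fin D)) =>
      Φ (q.1 + ∑ i, q.2 i) := hΦ.comp (by fun_prop)
  rw [← lintegral_prod_symm' _ hm, ← (measurePreserving_piFinSuccAbove μ k).lintegral_comp hm]
  refine lintegral_congr fun c => ?_
  rw [Fin.sum_univ_succAbove _ k]
  rfl

/-- The worst case over one series that is either perturbed or exchanged for another one. -/
lemma exchange_le {N N' b : ℕ} (hN : N' + b = N) {k a p δ : ℝ≥0} (hka : k ≤ a)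
    (hp : (N : ℝ≥0) * p = N' * δ) {h A A' B m M : ℝ≥0∞} (hA1 : A' ≠ ∞) (hB1 : B ≠ ∞)
    (hM : M ≠ ∞) (hmM : m ≤ M) (hA : A ≤ A' + δ * (M - m)) (hA' : m ≤ A')
    (hB : b * m ≤ B)
    (hMm : (k * p : ℝ≥0) * M ≤ (a - k + k * p : ℝ≥0) * m + h) :
    k * (N' * A + B) ≤ a * (N' * A' + B) + N * h := by
  rcases N.eq_zero_or_pos with rfl | hN0
  · obtain rfl : N' = 0 := by omega
    simp only [Nat.cast_zero, zero_mul, zero_add, add_zero]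
    gcongr
  by_cases hh : h = ∞
  · rw [hh, ENNReal.mul_top (by positivity)]
    simp
  have hAt : A ≠ ∞ := ne_top_of_le_ne_top (ENNReal.add_ne_top.mpr
    ⟨hA1, ENNReal.mul_ne_top ENNReal.coe_ne_top (ENNReal.sub_ne_top hM)⟩) hA
  have hm : m ≠ ∞ := ne_top_of_le_ne_top hM hmM
  lift h to ℝ≥0 using hh
  lift A to ℝ≥0 using hAt
  lift A' to ℝ≥0 using hA1
  lift B to ℝ≥0 using hB1
  lift m to ℝ≥0 using hm
  lift M to ℝ≥0 using hM
  norm_cast at *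
  have e1 : ((M - m : ℝ≥0) : ℝ) = M - m := NNReal.coe_sub hmM
  have e2 : ((a - k : ℝ≥0) : ℝ) = a - k := NNReal.coe_sub hka
  have e3 : (N : ℝ) = N' + b := by rw [← hN]; push_cast; ring
  rw [← NNReal.coe_le_coe] at *
  rw [← NNReal.coe_inj] at hp
  push_cast [e1, e2] at *
  have hk0 : (0 : ℝ) ≤ k := k.coe_nonneg
  have hak : (0 : ℝ) ≤ a - k := by linarith
  have hN'0 : (0 : ℝ) ≤ N' := N'.cast_nonneg
  have hN0' : (0 : ℝ) ≤ N := N.cast_nonneg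
  -- Replacing `A` by `A'` costs `k N' δ (M - m) = N k p (M - m)`. This is paid for by `N h` and by
  -- the slack `(a - k) (N' A' + B) ≥ (a - k) N m`; the latter is where `k ≤ a` and the batches
  -- without `n` enter.
  have t1 := mul_le_mul_of_nonneg_left hA (mul_nonneg hk0 hN'0)
  have t2 := mul_le_mul_of_nonneg_left hMm hN0'
  have t3 := mul_le_mul_of_nonneg_left hA' (mul_nonneg hak hN'0)
  have t4 := mul_le_mul_of_nonneg_left hB hak
  have t5 : (k : ℝ) * N' * (δ * (M - m)) = N * (k * p * M) - N * (k * p * m) := by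
    calc (k : ℝ) * N' * (δ * (M - m)) = (N' * δ) * (k * (M - m)) := by ring
      _ = _ := by rw [← hp]; ring
  rw [e3] at t2 t5 ⊢
  linarith

variable {N N' : ℕ} {ν ν' : Fin N → Measure (EuclideanSpace ℝ (Fin D))}
  [∀ i, IsProbabilityMeasure (ν i)] [∀ i, IsProbabilityMeasure (ν' i)]

/-- The bound for sampling without replacement: if only the law of the contribution of series `n`
depends on the dataset, then a random batch depends on the dataset only if it contains `n`, and
otherwise `n` can be exchanged for a member of the batch. -/
lemma sum_perm_lintegral_le (hN : N' ≤ N) (hN' : 0 < N') (n : Fin N)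
    (hne : ∀ i, i ≠ n → ν i = ν' i) {C : ℝ} (hν : ∀ i, ∀ᵐ c ∂ν i, ‖c‖ ≤ C)
    (hν' : ∀ᵐ c ∂ν' n, ‖c‖ ≤ C) {k a p δ : ℝ≥0} (hka : k ≤ a)
    (hp : (N : ℝ≥0) * p = N' * δ) (hδ : TestBound 1 1 δ (ν n) (ν' n)) {h : ℝ≥0∞}
    {Φ : EuclideanSpace ℝ (Fin D) → ℝ≥0∞} (hΦ : Measurable Φ) (hΦ1 : ∀ w, Φ w ≤ 1)
    (hΦC : ∀ w u, ‖w - u‖ ≤ C * 2 →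
      (k * p : ℝ≥0) * Φ w ≤ (a - k + k * p : ℝ≥0) * Φ u + h) :
    k * ∑ π : Equiv.Perm (Fin N),
        ∫⁻ c, Φ (∑ i, c i) ∂Measure.pi (fun i : Fin N' => ν (π (Fin.castLE hN i))) ≤
      ∑ π : Equiv.Perm (Fin N),
        (a * ∫⁻ c, Φ (∑ i, c i) ∂Measure.pi (fun i : Fin N' => ν' (π (Fin.castLE hN i))) + h) := by
  have hN0 : (N' : ℝ≥0∞) ≠ 0 := by simpa using hN'.ne'
  -- After multiplication by the batch size, both sides are compared for each fixed position `j` of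
  -- `n` and each `π`, together with all exchanges of `n` for an unselected series.
  rw [← ENNReal.mul_le_mul_iff_right hN0 (ENNReal.natCast_ne_top _), Finset.mul_sum,
    sum_perm_eq hN n, sum_perm_eq hN n]
  refine Finset.sum_le_sum fun j _ => Finset.sum_le_sum fun π hπ => ?_
  have hπ : π (Fin.castLE hN j) = n := (Finset.mem_filter.mp hπ).2
  obtain ⟨N', rfl⟩ := Nat.exists_eq_succ_of_ne_zero hN'.ne'
  set J : Finset (Fin N) := Finset.univ.filter fun l : Fin N => N' + 1 ≤ l with hJ
  have hcard : J.card = N - (N' + 1) := by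
    have : J = Finset.univ \ Finset.univ.image (Fin.castLE hN) := by
      ext l
      simp only [hJ, Finset.mem_filter, Finset.mem_univ, true_and, Finset.mem_sdiff,
        Finset.mem_image, not_exists]
      constructor
      · rintro h i rfl
        simp at h
        omega
      · intro h
        by_contra hl
        exact h ⟨l, by omega⟩ rfl
    rw [this, Finset.card_sdiff_of_subset (Finset.subset_univ _),
      Finset.card_image_of_injective _ (Fin.castLE_injective hN)]
    simp
  set ρ := Measure.pi fun i => ν (π (Fin.castLE hN (j.succAbove i))) with hρ
  set ψ : Measure (EuclideanSpace ℝ (Fin D)) → (Fin N' → EuclideanSpace ℝ (Fin D)) → ℝ≥0∞ :=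
    fun μ r => ∫⁻ c, Φ (c + ∑ i, r i) ∂μ with hψ
  have hψm : ∀ μ : Measure (EuclideanSpace ℝ (Fin D)), IsProbabilityMeasure μ →
      Measurable (ψ μ) := fun μ _ => by
    have hm : Measurable fun q : EuclideanSpace ℝ (Fin D) × (Fin N' → EuclideanSpace ℝ (Fin D)) =>
      Φ (q.1 + ∑ i, q.2 i) := hΦ.comp (by fun_prop)
    exact hm.lintegral_prod_left'
  have hpos : ∀ i, π (Fin.castLE hN (j.succAbove i)) ≠ n := fun i h =>
    Fin.succAbove_ne j i (Fin.castLE_injective hN (π.injective (h.trans hπ.symm)))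
  have hlj : ∀ l ∈ J, ∀ i, Fin.castLE hN i ≠ l := by
    rintro l hl i rfl
    have := (Finset.mem_filter.mp hl).2
    simp at this
    omega
  have hq : ∫⁻ c, Φ (∑ i, c i) ∂Measure.pi (fun i => ν (π (Fin.castLE hN i))) =
      ∫⁻ r, ψ (ν n) r ∂ρ := by
    rw [lintegral_pi_sum _ j hΦ, hπ]
  have hq' : ∫⁻ c, Φ (∑ i, c i) ∂Measure.pi (fun i => ν' (π (Fin.castLE hN i))) =
      ∫⁻ r, ψ (ν' n) r ∂ρ := by
    rw [lintegral_pi_sum _ j hΦ, hπ, hρ]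
    simp only [← hne _ (hpos _)]
    rfl
  have hswap : ∀ l ∈ J, ∀ i, (π * Equiv.swap (Fin.castLE hN j) l)
      (Fin.castLE hN (j.succAbove i)) = π (Fin.castLE hN (j.succAbove i)) := fun l hl i => by
    rw [Equiv.Perm.mul_apply, Equiv.swap_apply_of_ne_of_ne _ (hlj l hl _)]
    exact fun h => Fin.succAbove_ne j i (Fin.castLE_injective hN h)
  have hs : ∀ l ∈ J, ∫⁻ c, Φ (∑ i, c i) ∂Measure.pi
      (fun i => ν ((π * Equiv.swap (Fin.castLE hN j) l) (Fin.castLE hN i))) =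
      ∫⁻ r, ψ (ν (π l)) r ∂ρ := fun l hl => by
    rw [lintegral_pi_sum _ j hΦ]
    simp only [hswap l hl, Equiv.Perm.mul_apply, Equiv.swap_apply_left]
    rfl
  have hs' : ∀ l ∈ J, ∫⁻ c, Φ (∑ i, c i) ∂Measure.pi
      (fun i => ν' ((π * Equiv.swap (Fin.castLE hN j) l) (Fin.castLE hN i))) =
      ∫⁻ r, ψ (ν (π l)) r ∂ρ := fun l hl => by
    have hl' : π l ≠ n := fun h => hlj l hl j (π.injective (hπ.trans h.symm))
    rw [lintegral_pi_sum _ j hΦ]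
    simp only [hswap l hl, Equiv.Perm.mul_apply, Equiv.swap_apply_left, ← hne _ hl',
      ← hne _ (hpos _)]
    rfl
  -- Here the contributions `r` of the rest of the batch are fixed; their law `ρ` is shared by both
  -- datasets and by all exchanged batches.
  have key : ∀ r, (k : ℝ≥0∞) * ((N' + 1 : ℕ) * ψ (ν n) r + ∑ l ∈ J, ψ (ν (π l)) r) ≤
      a * ((N' + 1 : ℕ) * ψ (ν' n) r + ∑ l ∈ J, ψ (ν (π l)) r) + N * h := by
    intro r
    have hne0 : Nonempty {c : EuclideanSpace ℝ (Fin D) // ‖c‖ ≤ C} :=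
      let ⟨c, hc⟩ := (hν n).exists
      ⟨⟨c, hc⟩⟩
    set M := ⨆ c : {c : EuclideanSpace ℝ (Fin D) // ‖c‖ ≤ C}, Φ (c + ∑ i, r i) with hM
    set m := ⨅ c : {c : EuclideanSpace ℝ (Fin D) // ‖c‖ ≤ C}, Φ (c + ∑ i, r i) with hm
    have hbd : ∀ c : EuclideanSpace ℝ (Fin D), ‖c‖ ≤ C →
        m ≤ Φ (c + ∑ i, r i) ∧ Φ (c + ∑ i, r i) ≤ M := fun c hc =>
      ⟨iInf_le (fun c : {c : EuclideanSpace ℝ (Fin D) // ‖c‖ ≤ C} => Φ (c + ∑ i, r i)) ⟨c, hc⟩,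
        le_iSup (fun c : {c : EuclideanSpace ℝ (Fin D) // ‖c‖ ≤ C} => Φ (c + ∑ i, r i)) ⟨c, hc⟩⟩
    have hM1 : M ≠ ∞ := ne_top_of_le_ne_top ENNReal.one_ne_top (iSup_le fun c => hΦ1 _)
    have hmM : m ≤ M := let ⟨c, hc⟩ := hne0; (hbd c hc).1.trans (hbd c hc).2
    have hψ1 : ∀ μ : Measure (EuclideanSpace ℝ (Fin D)), IsProbabilityMeasure μ → ψ μ r ≤ 1 :=
      fun μ _ => (lintegral_mono fun c => hΦ1 _).trans_eq (by simp)
    have hmψ : ∀ μ : Measure (EuclideanSpace ℝ (Fin D)), IsProbabilityMeasure μ →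
        (∀ᵐ c ∂μ, ‖c‖ ≤ C) → m ≤ ψ μ r := fun μ _ hμ => by
      calc m = ∫⁻ _, m ∂μ := by simp
        _ ≤ ψ μ r := lintegral_mono_ae (hμ.mono fun c hc => (hbd c hc).1)
    refine exchange_le (Nat.add_sub_cancel' hN) hka hp
      (ne_top_of_le_ne_top ENNReal.one_ne_top (hψ1 _ inferInstance))
      (ENNReal.sum_ne_top.mpr fun l _ => ne_top_of_le_ne_top ENNReal.one_ne_top
        (hψ1 _ inferInstance)) hM1 hmM
      (hδ.lintegral_le (hΦ.comp (measurable_add_const _)) hM1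
        ((hν n).mono fun c hc => hbd c hc) (hν'.mono fun c hc => hbd c hc))
      (hmψ _ inferInstance hν') ?_ ?_
    · rw [← hcard, ← nsmul_eq_mul, ← Finset.sum_const]
      exact Finset.sum_le_sum fun l _ => hmψ _ inferInstance (hν _)
    · rw [hM, hm, ENNReal.mul_iSup, ENNReal.mul_iInf' (fun h0 => absurd h0 ENNReal.coe_ne_top)
        fun _ => hne0, ENNReal.iInf_add]
      refine iSup_le fun w => le_iInf fun u => hΦC _ _ ?_
      rw [add_sub_add_right_eq_sub]
      calc ‖(w : EuclideanSpace ℝ (Fin D)) - u‖ ≤ ‖(w : EuclideanSpace ℝ (Fin D))‖ +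
            ‖(u : EuclideanSpace ℝ (Fin D))‖ := norm_sub_le _ _
        _ ≤ C * 2 := by linarith [w.2, u.2]
  have hsum : ∀ μ : Measure (EuclideanSpace ℝ (Fin D)), IsProbabilityMeasure μ →
      ∫⁻ r, ((N' + 1 : ℕ) * ψ μ r + ∑ l ∈ J, ψ (ν (π l)) r) ∂ρ =
      (N' + 1 : ℕ) * ∫⁻ r, ψ μ r ∂ρ + ∑ l ∈ J, ∫⁻ r, ψ (ν (π l)) r ∂ρ := fun μ hμ => by
    rw [lintegral_add_left ((hψm μ hμ).const_mul _), lintegral_const_mul _ (hψm μ hμ),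
      lintegral_finsetSum _ fun l _ => hψm _ inferInstance]
  have hmeas : ∀ μ : Measure (EuclideanSpace ℝ (Fin D)), IsProbabilityMeasure μ →
      Measurable fun r => ((N' + 1 : ℕ) * ψ μ r + ∑ l ∈ J, ψ (ν (π l)) r) := fun μ hμ =>
    ((hψm μ hμ).const_mul _).add (Finset.measurable_sum _ fun l _ => hψm _ inferInstance)
  have := lintegral_mono (μ := ρ) key
  rw [lintegral_const_mul _ (hmeas _ inferInstance), hsum _ inferInstance,
    lintegral_add_right _ measurable_const, lintegral_const_mul _ (hmeas _ inferInstance),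
    hsum _ inferInstance, lintegral_const, measure_univ, mul_one] at this
  have e : (N : ℝ≥0∞) * h = (N' + 1 : ℕ) * h + ∑ l ∈ J, h := by
    rw [Finset.sum_const, hcard, nsmul_eq_mul, ← add_mul, ← Nat.cast_add, Nat.add_sub_cancel' hN]
  calc _ = (k : ℝ≥0∞) * ((N' + 1 : ℕ) * ∫⁻ r, ψ (ν n) r ∂ρ +
        ∑ l ∈ J, ∫⁻ r, ψ (ν (π l)) r ∂ρ) := by
        rw [hq, mul_add, Finset.mul_sum, mul_left_comm]
        exact congrArg _ (Finset.sum_congr rfl fun l hl => by rw [hs l hl])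
    _ ≤ _ := this
    _ = (N' + 1 : ℕ) * (a * ∫⁻ r, ψ (ν' n) r ∂ρ + h) +
        ∑ l ∈ J, (a * ∫⁻ r, ψ (ν (π l)) r ∂ρ + h) := by
        rw [e, Finset.sum_add_distrib, ← Finset.mul_sum]
        ring
    _ = _ := by
        rw [hq']
        exact congrArg _ (Finset.sum_congr rfl fun l hl => by rw [hs' l hl])

end Exchange


/-! ### The privacy profile of the training step -/

lemma mog_pair_apply (p σ : ℝ) (S : Set ℝ) : mog ![0, 2] ![1 - p, p] σ S =
    ENNReal.ofReal (1 - p) * normal 0 σ S + ENNReal.ofReal p * normal 2 σ S := by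
  simp [mog, Fin.sum_univ_two]

lemma isProbabilityMeasure_mog_pair {p : ℝ} (σ : ℝ) (hp0 : 0 ≤ p) (hp1 : p ≤ 1) :
    IsProbabilityMeasure (mog ![0, 2] ![1 - p, p] σ) :=
  ⟨by rw [mog_pair_apply, measure_univ, measure_univ, mul_one, mul_one,
    ← ENNReal.ofReal_add (by linarith) hp0, sub_add_cancel, ENNReal.ofReal_one]⟩

/-- A test bound for a mixture against one of its components bounds the other component. -/
lemma testBound_of_mog {k a : ℝ≥0} {h : ℝ≥0∞} (hka : k ≤ a) {σ : ℝ} {p : ℝ≥0} (hp1 : p ≤ 1)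
    (H : TestBound k a h (mog ![0, 2] ![1 - (p : ℝ), p] σ) (normal 0 σ)) :
    TestBound (k * p) (a - k + k * p) h (normal 2 σ) (normal 0 σ) := fun S hS => by
  by_cases hh : h = ∞
  · simp [hh]
  have H := H S hS
  have e1 : ENNReal.ofReal (1 - (p : ℝ)) = ((1 - p : ℝ≥0) : ℝ≥0∞) := by
    rw [← NNReal.coe_one, ← NNReal.coe_sub hp1, ENNReal.ofReal_coe_nnreal]
  rw [mog_pair_apply, e1, ENNReal.ofReal_coe_nnreal] at H
  have h0 : normal 0 σ S ≠ ∞ := measure_ne_top _ _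
  have h2 : normal 2 σ S ≠ ∞ := measure_ne_top _ _
  lift h to ℝ≥0 using hh
  lift normal 0 σ S to ℝ≥0 using h0 with q0
  lift normal 2 σ S to ℝ≥0 using h2 with q2
  norm_cast at *
  have e2 : ((1 - p : ℝ≥0) : ℝ) = 1 - p := NNReal.coe_sub hp1
  have e3 : ((a - k : ℝ≥0) : ℝ) = a - k := NNReal.coe_sub hka
  rw [← NNReal.coe_le_coe] at H ⊢
  push_cast [e2, e3] at H ⊢
  linarith

lemma EventNeighbor.symm {N L w : ℕ} {v : ℝ} {x x' : Fin N → Fin L → ℝ}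
    (H : EventNeighbor w v x x') : EventNeighbor w v x' x := by
  obtain ⟨n, h1, ⟨t, h2⟩, h3⟩ := H
  exact ⟨n, fun m hm => (h1 m hm).symm, ⟨t, fun s hs => h2 s hs.symm⟩,
    fun s => by rw [abs_sub_comm]; exact h3 s⟩

/-- Neighboring datasets are equal or differ in a single entry. -/
lemma EventNeighbor.eq_or_exists {N L : ℕ} {v : ℝ} {x x' : Fin N → Fin L → ℝ}
    (H : EventNeighbor 1 v x x') : x = x' ∨ ∃ (n : Fin N) (u : Fin L), (∀ m, m ≠ n → x m = x' m) ∧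
      (∀ i, i ≠ u → x n i = x' n i) ∧ |x n u - x' n u| ≤ v := by
  obtain ⟨n, h1, ⟨t, h2⟩, h3⟩ := H
  by_cases h : ∃ u, x n u ≠ x' n u
  · obtain ⟨u, hu⟩ := h
    refine Or.inr ⟨n, u, h1, fun i hi => ?_, h3 u⟩
    by_contra hne
    have := h2 u hu
    have := h2 i hne
    exact hi (Fin.ext (by omega))
  · push Not at h
    refine Or.inl (funext fun m => ?_)
    rcases eq_or_ne m n with rfl | hm
    · exact funext h
    · exact h1 m hm

section Profile

variable {L LC LF D N : ℕ} {O : Type*} {Λ : ℕ}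
  {f : EuclideanSpace ℝ (Fin D) → (Fin LC → ℝ) → O} {ℓ : O → (Fin LF → ℝ) → ℝ}
  {θ : EuclideanSpace ℝ (Fin D)}

lemma measurable_clip {C : ℝ} : Measurable (clip C : EuclideanSpace ℝ (Fin D) → _) := by
  unfold clip
  fun_prop

lemma measurable_uncurry_clip
    (hmeas : Measurable fun q : (Fin LC → ℝ) × (Fin LF → ℝ) => lossGradient f ℓ θ q.1 q.2) (C : ℝ) :
    Measurable (Function.uncurry fun c z => clip C (lossGradient f ℓ θ c z)) :=
  measurable_clip.comp hmeas

lemma isProbabilityMeasure_stepLaw (lam : ℕ) (hN : Λ / lam ≤ N) (hL : LF ≤ L)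
    (hmeas : Measurable fun q : (Fin LC → ℝ) × (Fin LF → ℝ) => lossGradient f ℓ θ q.1 q.2)
    (η σ C σC σF v : ℝ) (x : Fin N → Fin L → ℝ) :
    IsProbabilityMeasure (stepLaw lam Λ hN f ℓ θ η σ C σC σF v x) := by
  have hG := measurable_uncurry_clip hmeas C
  rw [stepLaw_eq hN hL f ℓ θ η σ C σC σF v hG x]
  have := fun a => isProbabilityMeasure_seriesLaw (lam := lam) hG hL (σC * v) (σF * v) a
  exact Measure.isProbabilityMeasure_map (by fun_prop)

/-- The constants `k`, `a`, `h` stay general so that both regimes of `α` follow. The final affine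
update is post-processing, and `Φ` integrates out the output noise before the batches are compared.
-/
lemma testBound_stepLaw (hN : Λ / 1 ≤ N) (hΛ : 1 ≤ Λ) (hL : LF ≤ L)
    (hmeas : Measurable fun q : (Fin LC → ℝ) × (Fin LF → ℝ) => lossGradient f ℓ θ q.1 q.2)
    {η σ C s v : ℝ} (hC : 0 < C) (hv : 0 ≤ v) {δ p : ℝ≥0}
    (hδ : (δ : ℝ) = ((LC : ℝ) + LF) / ((L : ℝ) - LF + 1) * tvd (normal 0 s) (normal 1 s))
    (hp : (p : ℝ) = ((Λ / 1 : ℕ) : ℝ) / N * δ) (hp1 : p ≤ 1) {k a : ℝ≥0} (hka : k ≤ a) {h : ℝ≥0∞}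
    (H : TestBound k a h (mog ![0, 2] ![1 - (p : ℝ), p] σ) (normal 0 σ))
    {x x' : Fin N → Fin L → ℝ} (hx : EventNeighbor 1 v x x') :
    TestBound k a h (stepLaw 1 Λ hN f ℓ θ η σ C s s v x)
      (stepLaw 1 Λ hN f ℓ θ η σ C s s v x') := by
  obtain rfl | ⟨n, u, h1, h2, h3⟩ := hx.eq_or_exists
  · exact testBound_refl hka _
  have hG := measurable_uncurry_clip hmeas C
  have hprob := fun a => isProbabilityMeasure_seriesLaw (lam := 1) hG hL (s * v) (s * v) a
  rw [stepLaw_eq hN hL f ℓ θ η σ C s s v hG x, stepLaw_eq hN hL f ℓ θ η σ C s s v hG x']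
  refine TestBound.map (fun S hS => ?_) (by fun_prop)
  set ν : (Fin N → Fin L → ℝ) → Fin N → Measure (EuclideanSpace ℝ (Fin D)) := fun x i =>
    seriesLaw 1 (fun c z => clip C (lossGradient f ℓ θ c z)) (s * v) (s * v) (x i)
  set Z : Measure (Fin D → ℝ) := Measure.pi fun _ => normal 0 (σ * C)
  set Φ : EuclideanSpace ℝ (Fin D) → ℝ≥0∞ := fun w => (Z.map fun z => w + WithLp.toLp 2 z) S 
  have hZ : ∀ w : EuclideanSpace ℝ (Fin D),
      IsProbabilityMeasure (Z.map fun z => w + WithLp.toLp 2 z) := fun w =>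
    Measure.isProbabilityMeasure_map (by fun_prop)
  have hΦm : Measurable Φ := by
    have hm : Measurable fun q : EuclideanSpace ℝ (Fin D) × (Fin D → ℝ) =>
      q.1 + WithLp.toLp 2 q.2 := by fun_prop
    have : Φ = fun w => Z (Prod.mk w ⁻¹' ((fun q : EuclideanSpace ℝ (Fin D) × (Fin D → ℝ) =>
        q.1 + WithLp.toLp 2 q.2) ⁻¹' S)) := funext fun w => by
      exact Measure.map_apply (by fun_prop) hS
    rw [this]
    exact measurable_measure_prodMk_left (hm hS)
  have hC1 : ∀ y i, ∀ᵐ c ∂ν y i, ‖c‖ ≤ C := fun y i => by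
    simpa using seriesLaw_ae_norm_le 1 hG (fun c z => norm_clip_le hC _) (s * v) (s * v) (y i)
  have hN0 : (N : ℝ) ≠ 0 := by
    have : 0 < N := (Nat.zero_le _).trans_lt n.2
    positivity
  have hδ' : TestBound 1 1 (δ : ℝ≥0∞) (ν x n) (ν x' n) := by
    have := testBound_seriesLaw hG hL s hv u h2 h3
    rwa [← hδ, ENNReal.ofReal_coe_nnreal] at this
  have main := sum_perm_lintegral_le hN ((Nat.div_one Λ).symm ▸ hΛ) n
    (fun i hi => by simp only [ν, h1 i hi]) (hC1 x) (hC1 x' n) hka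
    (by rw [← NNReal.coe_inj]; push_cast; rw [hp]; field_simp) hδ' hΦm (fun w => prob_le_one)
    (fun w u hwu => (testBound_of_mog hka hp1 H).gaussian_translate le_add_self hC.le hwu S hS)
  rw [uniformMixture_apply, uniformMixture_apply, mul_left_comm]
  simp only [noisySumLaw_apply _ _ hS]
  refine (mul_le_mul_right main _).trans_eq ?_
  rw [Finset.sum_add_distrib, ← Finset.mul_sum, mul_add, mul_left_comm, Finset.sum_const,
    nsmul_eq_mul, ← mul_assoc _ _ h, Finset.card_univ, card_inv_mul_card, one_mul]

end Profile

end DPForecast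

open DPForecast
theorem theorem4p5 {L LC LF D N : ℕ} {O : Type*}
    (hL : LC + LF ≤ L + 1 - LF)
    (lam Λ : ℕ) (hlam : lam = 1) (hΛ : 1 ≤ Λ) (hN : Λ / lam ≤ N)
    (f : EuclideanSpace ℝ (Fin D) → (Fin LC → ℝ) → O) (ℓ : O → (Fin LF → ℝ) → ℝ)
    (θ : EuclideanSpace ℝ (Fin D))
    (hmeas : Measurable fun q : (Fin LC → ℝ) × (Fin LF → ℝ) => lossGradient f ℓ θ q.1 q.2)
    (η σ C σC σF v : ℝ) (hσ : 0 ≤ σ) (hC : 0 < C)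
    (hσC : 0 ≤ σC) (hσF : 0 ≤ σF) (hCF : σC = σF) (hv : 0 ≤ v) :
    let r : ℝ := ((LC : ℝ) + LF) / ((L : ℝ) - LF + 1)
    let ρ : ℝ := ((Λ / lam : ℕ) : ℝ) / N
    let p₂ : ℝ := ρ * r * tvd (normal 0 σF) (normal 1 σF)
    let P : Measure ℝ := mog ![0, 2] ![1 - p₂, p₂] σ
    let Q : Measure ℝ := normal 0 σ
    let H : ℝ≥0 → ℝ≥0∞ := fun α =>
      ⨆ (x : Fin N → Fin L → ℝ) (x' : Fin N → Fin L → ℝ) (_ : EventNeighbor 1 v x x'),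
        hockeyStick α (stepLaw lam Λ hN f ℓ θ η σ C σC σF v x)
          (stepLaw lam Λ hN f ℓ θ η σ C σC σF v x')
    (0 ≤ p₂ ∧ p₂ ≤ 1) ∧
      ∀ α : ℝ≥0,
        (1 ≤ α → H α ≤ hockeyStick α P Q) ∧ (α < 1 → H α ≤ hockeyStick α Q P) := by
  subst hlam hCF
  intro r ρ p₂ P Q H
  have hL' : LF ≤ L := by omega
  have hNpos : 0 < N := lt_of_lt_of_le ((Nat.div_one Λ).symm ▸ hΛ) hN
  have hρ0 : 0 ≤ ρ := by positivity
  have hρ1 : ρ ≤ 1 := div_le_one_of_le₀ (by exact_mod_cast hN) (Nat.cast_nonneg _)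
  have hT : (0 : ℝ) < (L : ℝ) - LF + 1 := by
    have : (LF : ℝ) ≤ L := by exact_mod_cast hL'
    linarith
  have hr0 : 0 ≤ r := div_nonneg (by positivity) hT.le
  have hr1 : r ≤ 1 := by
    refine div_le_one_of_le₀ ?_ hT.le
    have h1 : LC + LF + LF ≤ L + 1 := by omega
    have h2 : (LC : ℝ) + LF + LF ≤ L + 1 := by exact_mod_cast h1
    linarith
  have hτ0 := tvd_nonneg (normal 0 σC) (normal 1 σC)
  have hτ1 := tvd_le_one (normal 0 σC) (normal 1 σC)
  have hp0 : 0 ≤ p₂ := mul_nonneg (mul_nonneg hρ0 hr0) hτ0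
  have hp1 : p₂ ≤ 1 := mul_le_one₀ (mul_le_one₀ hρ1 hr0 hr1) hτ0 hτ1
  refine ⟨⟨hp0, hp1⟩, fun α => ?_⟩
  have : IsProbabilityMeasure P := isProbabilityMeasure_mog_pair σ hp0 hp1
  have hstep := isProbabilityMeasure_stepLaw 1 hN hL' hmeas η σ C σC σC v
  have key : ∀ {k a : ℝ≥0} (_ : k ≤ a) {h : ℝ≥0∞} (_ : TestBound k a h P Q)
      {x x' : Fin N → Fin L → ℝ} (_ : EventNeighbor 1 v x x'),
      TestBound k a h (stepLaw 1 Λ hN f ℓ θ η σ C σC σC v x)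
        (stepLaw 1 Λ hN f ℓ θ η σ C σC σC v x') := fun hka _ hH _ _ hx =>
    testBound_stepLaw hN hΛ hL' hmeas hC hv
      (δ := ⟨r * tvd (normal 0 σC) (normal 1 σC), mul_nonneg hr0 hτ0⟩) (p := ⟨p₂, hp0⟩) rfl
      (mul_assoc _ _ _) hp1 hka hH hx
  constructor
  · intro hα
    exact iSup_le fun x => iSup_le fun x' => iSup_le fun hx =>
      hockeyStick_le (key hα (testBound_hockeyStick α P Q) hx)
  · intro hα
    -- Complements exchange the roles of the two laws, so the pair is used in reverse order, which
    -- symmetry of the neighboring relation allows.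
    exact iSup_le fun x => iSup_le fun x' => iSup_le fun hx =>
      hockeyStick_le_of_testBound_swap hα.le (one_sub_le_hockeyStick α Q P)
        (key hα.le (testBound_hockeyStick_swap hα.le P Q) hx.symm)
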